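/- \textbf{Conventions.} An \emph{inverse semigroup} is a semigroup $S$ in which every $s\in S$ has a unique inverse, i.e. a unique $s^{*}\in S$ with $ss^{*}s=s$ and $s^{*}ss^{*}=s^{*}$. Let $E(S)$ be its set of idempotents, partially ordered by $e\le f\iff e=ef=fe$; $E(S)$ is \emph{uniformly locally finite} if $\sup_{e\in E(S)}|\{f\in E(S): f\le e\}|<\infty$. For $p\in E(S)$ the \emph{maximal subgroup} at $p$ is $G_p=\{s\in S: ss^{*}=s^{*}s=p\}$, a (discrete) group with identity $p$. The equivalence relation $\mathfrak D$ on $S$ is given by $s\,\mathfrak D\,t$ if and only if there is $x\in S$ with $ss^{*}=xx^{*}$ and $t^{*}t=x^{*}x$. $\ell^{1}(S)$ is the complex Banach algebra of absolutely summable functions on $S$ with the $\ell^1$-norm and the convolution product $(f*g)(s)=\sum_{tu=s}f(t)g(u)$. A group is \emph{amenable} if it has a left invariant mean on its bounded functions. For a Banach algebra $A$, let $A\otimes_{p}A$ be the projective tensor product, with the actions $a\cdot(b\otimes c)=ab\otimes c$, $(b\otimes c)\cdot a=b\otimes ca$, and let $\pi_A:A\otimes_pA\to A$, $\pi_A(a\otimes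 b)=ab$, be the product map. Biduals carry the induced module actions (the dual $X^{*}$ of a bimodule $X$ having $(a\cdot f)(x)=f(x\cdot a)$, $(f\cdot a)(x)=f(a\cdot x)$). $A$ is \emph{strong pseudo-amenable} if there is a (not necessarily bounded) net $(m_\alpha)$ in $(A\otimes_pA)^{**}$ such that for every $a\in A$, in norm, $$a\cdot m_\alpha-m_\alpha\cdot a\to0\quad\text{and}\quad a\cdot\pi_A^{**}(m_\alpha)=\pi_A^{**}(m_\alpha)\cdot a\to a ,$$ where the equality holds for every $\alpha$ and $A$ is regarded as a subspace of $A^{**}$. \textbf{Theorem.} Let $S$ be an inverse semigroup such that $E(S)$ is uniformly locally finite. Then the following are equivalent: \begin{enumerate} \item[(i)] $\ell^{1}(S)$ is strong pseudo-amenable; \item[(ii)] every maximal subgroup $G_p$ $(p\in E(S))$ of $S$ is amenable, and every $\mathfrak D$-class of $S$ contains only finitely many idempotents. \end{enumerate} -/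

import Mathlib

open scoped ENNReal TensorProduct
open Filter Topology

noncomputable section

/-! ## Banach algebras: projective tensor square, biduals, strong pseudo-amenability -/

namespace BanachAlg

section Bidual

variable {X Y : Type*} [NormedAddCommGroup X] [NormedSpace ℂ X]
  [NormedAddCommGroup Y] [NormedSpace ℂ Y]

/-- The Banach space adjoint `T* : Y* → X*`, `T* f = f ∘ T`. -/
def adj (T : X →L[ℂ] Y) : StrongDual ℂ Y →L[ℂ] StrongDual ℂ X :=
  (ContinuousLinearMap.compL ℂ X Y ℂ).flip T

theorem adj_apply (T : X →L[ℂ] Y) (f : StrongDual ℂ Y) (x : X) : adj T f x = f (T x) := rfl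

/-- The second adjoint `T** : X** → Y**`. -/
def biadj (T : X →L[ℂ] Y) :
    StrongDual ℂ (StrongDual ℂ X) →L[ℂ] StrongDual ℂ (StrongDual ℂ Y) :=
  adj (adj T)

theorem biadj_apply (T : X →L[ℂ] Y) (m : StrongDual ℂ (StrongDual ℂ X)) (f : StrongDual ℂ Y) :
    biadj T m f = m (adj T f) := rfl

end Bidual

section Projective

variable (A : Type*) [NonUnitalNormedRing A] [NormedSpace ℂ A]

/-- The projective tensor product `A ⊗ₚ A`: the completion of the algebraic tensor square of `A`
for the projective seminorm (which is the norm that Mathlib puts on `PiTensorProduct`). -/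
abbrev ProjSq : Type _ := UniformSpace.Completion (⨂[ℂ] _ : Fin 2, A)

variable {A}

/-- The elementary tensor `a ⊗ b` in `A ⊗ₚ A`. -/
def tmul (a b : A) : ProjSq A :=
  ((PiTensorProduct.tprod ℂ ![a, b] : ⨂[ℂ] _ : Fin 2, A) : ProjSq A)

/-- For bounded operators `T₀, T₁` on `A`, the operator `T₀ ⊗ T₁` on `A ⊗ₚ A`. -/
def mapSq (T₀ T₁ : A →L[ℂ] A) : ProjSq A →L[ℂ] ProjSq A :=
  (PiTensorProduct.mapL (𝕜 := ℂ) (E := fun _ : Fin 2 => A) (E' := fun _ : Fin 2 => A)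
    ![T₀, T₁]).completion

theorem mapSq_tmul (T₀ T₁ : A →L[ℂ] A) (a b : A) :
    mapSq T₀ T₁ (tmul a b) = tmul (T₀ a) (T₁ b) := by
  simp only [mapSq, tmul]
  rw [ContinuousLinearMap.completion_apply_coe, PiTensorProduct.mapL_apply,
    PiTensorProduct.map_tprod]
  congr 2
  ext i
  fin_cases i <;> rfl

variable [IsScalarTower ℂ A A] [SMulCommClass ℂ A A]

/-- Multiplication `b ↦ a * b` by `a` on the left. -/
def mulLeft (a : A) : A →L[ℂ] A := ContinuousLinearMap.mul ℂ A a

/-- Multiplication `b ↦ b * a` by `a` on the right. -/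
def mulRight (a : A) : A →L[ℂ] A := (ContinuousLinearMap.mul ℂ A).flip a

/-- The left action of `a` on `A ⊗ₚ A`, `a · (b ⊗ c) = (a * b) ⊗ c`. -/
def lactSq (a : A) : ProjSq A →L[ℂ] ProjSq A := mapSq (mulLeft a) (ContinuousLinearMap.id ℂ A)

/-- The right action of `a` on `A ⊗ₚ A`, `(b ⊗ c) · a = b ⊗ (c * a)`. -/
def ractSq (a : A) : ProjSq A →L[ℂ] ProjSq A := mapSq (ContinuousLinearMap.id ℂ A) (mulRight a)

theorem lactSq_tmul (a b c : A) : lactSq a (tmul b c) = tmul (a * b) c := mapSq_tmul _ _ _ _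

theorem ractSq_tmul (a b c : A) : ractSq a (tmul b c) = tmul b (c * a) := mapSq_tmul _ _ _ _

variable (A) in
/-- The multiplication of `A` as a bounded multilinear map of two variables. -/
def mulMultilinear : ContinuousMultilinearMap ℂ (fun _ : Fin 2 => A) A :=
  MultilinearMap.mkContinuous
    { toFun := fun v => v 0 * v 1
      map_update_add' := by
        intro _ v i x y
        fin_cases i <;> simp [Function.update, add_mul, mul_add]
      map_update_smul' := by
        intro _ v i c x
        fin_cases i <;> simp [Function.update, smul_mul_assoc, mul_smul_comm] }
    1 (fun v => by simpa [Fin.prod_univ_two] using norm_mul_le (v 0) (v 1))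

variable [CompleteSpace A]

variable (A) in
/-- The product morphism `π_A : A ⊗ₚ A → A`, `a ⊗ b ↦ a * b`. -/
def prodMor : ProjSq A →L[ℂ] A :=
  (PiTensorProduct.liftIsometry ℂ (fun _ : Fin 2 => A) A (mulMultilinear A)).extend
    (UniformSpace.Completion.toComplL (𝕜 := ℂ) (E := ⨂[ℂ] _ : Fin 2, A))

theorem prodMor_tmul (a b : A) : prodMor A (tmul a b) = a * b := by
  have h := ContinuousLinearMap.extend_eq
    (PiTensorProduct.liftIsometry ℂ (fun _ : Fin 2 => A) A (mulMultilinear A))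
    (e := UniformSpace.Completion.toComplL (𝕜 := ℂ) (E := ⨂[ℂ] _ : Fin 2, A))
    UniformSpace.Completion.denseRange_coe
    (UniformSpace.Completion.isUniformInducing_coe _) (PiTensorProduct.tprod ℂ ![a, b])
  refine Eq.trans h ?_
  rw [PiTensorProduct.liftIsometry_apply_apply, PiTensorProduct.lift.tprod]
  rfl

end Projective

/-- A Banach algebra `A` is strong pseudo-amenable if there is a (not necessarily bounded) net
`m` in `(A ⊗ₚ A)**` such that for all `a`, in norm, `a · m i - m i · a → 0` and
`a · π_A**(m i) = π_A**(m i) · a → a`, where `A` is embedded canonically in `A**`.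

The module actions on a bidual `X**` are those induced twice by
`(a · f) x = f (x · a)`, `(f · a) x = f (a · x)` on duals;
thus `a · m` and `m · a` are the second adjoints of the two actions, applied to `m`. -/
def StrongPseudoAmenable.{u} (A : Type u) [NonUnitalNormedRing A] [NormedSpace ℂ A]
    [IsScalarTower ℂ A A] [SMulCommClass ℂ A A] [CompleteSpace A] : Prop :=
  ∃ (ι : Type u) (_ : Preorder ι) (_ : IsDirectedOrder ι) (_ : Nonempty ι)
    (m : ι → StrongDual ℂ (StrongDual ℂ (ProjSq A))),
    ∀ a : A,
      Tendsto (fun i => biadj (lactSq a) (m i) - biadj (ractSq a) (m i)) atTop (𝓝 0) ∧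
      (∀ i, biadj (mulLeft a) (biadj (prodMor A) (m i)) =
        biadj (mulRight a) (biadj (prodMor A) (m i))) ∧
      Tendsto (fun i => biadj (mulLeft a) (biadj (prodMor A) (m i))) atTop
        (𝓝 (NormedSpace.inclusionInDoubleDual ℂ A a))

end BanachAlg

/-! ## The convolution algebra `ℓ¹(S)` of a semigroup -/

/-- The Banach space `ℓ¹(S)` of absolutely summable functions `S → ℂ`; for a semigroup `S` it
carries the convolution product below. -/
def L1Alg (S : Type*) : Type _ := lp (fun _ : S => ℂ) 1

namespace L1Alg

variable {S : Type*}

instance : NormedAddCommGroup (L1Alg S) :=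
  inferInstanceAs (NormedAddCommGroup (lp (fun _ : S => ℂ) 1))
instance : NormedSpace ℂ (L1Alg S) := inferInstanceAs (NormedSpace ℂ (lp (fun _ : S => ℂ) 1))
instance : CompleteSpace (L1Alg S) := inferInstanceAs (CompleteSpace (lp (fun _ : S => ℂ) 1))
instance : CoeFun (L1Alg S) (fun _ => S → ℂ) := ⟨fun f => f.1⟩

theorem ext' {f g : L1Alg S} (h : ∀ s, f s = g s) : f = g := lp.ext (funext h)

theorem hasSum_norm (f : L1Alg S) : HasSum (fun s => ‖f s‖) ‖f‖ := by
  have h := lp.hasSum_norm (E := fun _ : S => ℂ) (p := 1) (by simp) f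
  simp only [ENNReal.toReal_one, Real.rpow_one] at h
  exact h

theorem summable_prod (f g : L1Alg S) : Summable (fun p : S × S => ‖f p.1 * g p.2‖) := by
  simpa using f.hasSum_norm.summable.mul_of_nonneg g.hasSum_norm.summable
    (fun _ => norm_nonneg _) (fun _ => norm_nonneg _)

theorem hasSum_prod_norm (f g : L1Alg S) :
    HasSum (fun p : S × S => ‖f p.1 * g p.2‖) (‖f‖ * ‖g‖) := by
  have h := f.hasSum_norm.mul g.hasSum_norm (by simpa using summable_prod f g)
  simpa using h

open scoped Classical in
/-- The point mass `a δ_s`. -/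
def single (s : S) (a : ℂ) : L1Alg S := lp.single (E := fun _ : S => ℂ) 1 s a

open scoped Classical in
theorem single_apply (s : S) (a : ℂ) (t : S) : single s a t = if t = s then a else 0 := by
  change (Pi.single s a : S → ℂ) t = _
  rw [Pi.single_apply]

theorem ext_clm {F : Type*} [NormedAddCommGroup F] [NormedSpace ℂ F] {T U : L1Alg S →L[ℂ] F}
    (h : ∀ s a, T (single s a) = U (single s a)) (f : L1Alg S) : T f = U f := by
  classical
  have key : (show lp (fun _ : S => ℂ) 1 →L[ℂ] F from T) = U := by
    refine lp.ext_continuousLinearMap (by simp) fun s => ?_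
    ext
    have h1 := h s 1
    unfold single at h1
    exact h1
  exact DFunLike.congr_fun key f

variable [Semigroup S]

/-- The convolution `(f * g)(s) = ∑_{tu = s} f(t) g(u)`. -/
def convFun (f g : L1Alg S) (s : S) : ℂ :=
  ∑' p : {p : S × S // p.1 * p.2 = s}, f p.1.1 * g p.1.2

theorem summable_fiber (f g : L1Alg S) (s : S) :
    Summable (fun p : {p : S × S // p.1 * p.2 = s} => ‖f p.1.1 * g p.1.2‖) :=
  (summable_prod f g).comp_injective Subtype.val_injective

theorem summable_fiber' (f g : L1Alg S) (s : S) :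
    Summable (fun p : {p : S × S // p.1 * p.2 = s} => f p.1.1 * g p.1.2) :=
  (summable_fiber f g s).of_norm

theorem hasSum_fiber_norm (f g : L1Alg S) :
    HasSum (fun s => ∑' p : {p : S × S // p.1 * p.2 = s}, ‖f p.1.1 * g p.1.2‖) (‖f‖ * ‖g‖) := by
  have h := (Equiv.sigmaFiberEquiv (fun p : S × S => p.1 * p.2)).hasSum_iff.mpr
    (hasSum_prod_norm f g)
  exact h.sigma (fun s => (summable_fiber f g s).hasSum)

theorem norm_convFun_le (f g : L1Alg S) (s : S) :
    ‖convFun f g s‖ ≤ ∑' p : {p : S × S // p.1 * p.2 = s}, ‖f p.1.1 * g p.1.2‖ :=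
  norm_tsum_le_tsum_norm (summable_fiber f g s)

theorem summable_norm_convFun (f g : L1Alg S) : Summable (fun s => ‖convFun f g s‖) :=
  (hasSum_fiber_norm f g).summable.of_nonneg_of_le (fun _ => norm_nonneg _) (norm_convFun_le f g)

/-- Convolution as an element of `ℓ¹(S)`. -/
def conv (f g : L1Alg S) : L1Alg S :=
  ⟨convFun f g, memℓp_gen (by simpa using summable_norm_convFun f g)⟩

theorem conv_apply (f g : L1Alg S) (s : S) : conv f g s = convFun f g s := rfl

theorem norm_conv_le (f g : L1Alg S) : ‖conv f g‖ ≤ ‖f‖ * ‖g‖ :=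
  hasSum_le (norm_convFun_le f g) (conv f g).hasSum_norm (hasSum_fiber_norm f g)

theorem add_conv (f f' g : L1Alg S) : conv (f + f') g = conv f g + conv f' g :=
  ext' fun s => Eq.trans (tsum_congr fun p => add_mul (f p.1.1) (f' p.1.1) (g p.1.2))
    ((summable_fiber' f g s).tsum_add (summable_fiber' f' g s))

theorem conv_add (f g g' : L1Alg S) : conv f (g + g') = conv f g + conv f g' :=
  ext' fun s => Eq.trans (tsum_congr fun p => mul_add (f p.1.1) (g p.1.2) (g' p.1.2))
    ((summable_fiber' f g s).tsum_add (summable_fiber' f g' s))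

theorem smul_conv (c : ℂ) (f g : L1Alg S) : conv (c • f) g = c • conv f g :=
  ext' fun _ => Eq.trans (tsum_congr fun p => mul_assoc c (f p.1.1) (g p.1.2)) tsum_mul_left

theorem conv_smul (c : ℂ) (f g : L1Alg S) : conv f (c • g) = c • conv f g :=
  ext' fun _ => Eq.trans (tsum_congr fun p => mul_left_comm (f p.1.1) c (g p.1.2)) tsum_mul_left

variable (S) in
/-- Convolution as a bounded bilinear map. -/
def convL : L1Alg S →L[ℂ] L1Alg S →L[ℂ] L1Alg S :=
  LinearMap.mkContinuous₂ (LinearMap.mk₂ ℂ conv add_conv smul_conv conv_add conv_smul) 1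
    (fun f g => by simpa using norm_conv_le f g)

theorem convL_apply (f g : L1Alg S) : convL S f g = conv f g := rfl

theorem conv_single (s t : S) (a b : ℂ) :
    conv (single s a) (single t b) = single (s * t) (a * b) := by
  classical
  refine ext' fun u => ?_
  rw [conv_apply, convFun, single_apply]
  split_ifs with h
  · rw [tsum_eq_single ⟨(s, t), h.symm⟩]
    · simp [single_apply]
    · rintro ⟨⟨x, y⟩, hxy⟩ hne
      simp only [single_apply]
      by_cases hx : x = s
      · by_cases hy : y = t
        · exact absurd (by subst hx; subst hy; rfl) hne
        · simp [hy]
      · simp [hx]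
  · refine Eq.trans (tsum_congr fun p => ?_) tsum_zero
    obtain ⟨⟨x, y⟩, hxy⟩ := p
    simp only [single_apply]
    by_cases hx : x = s
    · by_cases hy : y = t
      · subst hx; subst hy; exact absurd hxy.symm h
      · simp [hy]
    · simp [hx]

theorem conv_assoc (f g h : L1Alg S) : conv (conv f g) h = conv f (conv g h) := by
  refine ext_clm (T := convL S (conv f g)) (U := (convL S f).comp (convL S g)) (fun u c => ?_) h
  refine ext_clm (T := ((convL S).flip (single u c)).comp (convL S f))
    (U := (convL S f).comp ((convL S).flip (single u c))) (fun t b => ?_) g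
  refine ext_clm (T := ((convL S).flip (single u c)).comp ((convL S).flip (single t b)))
    (U := (convL S).flip (conv (single t b) (single u c))) (fun s a => ?_) f
  change conv (conv (single s a) (single t b)) (single u c) =
    conv (single s a) (conv (single t b) (single u c))
  simp only [conv_single, mul_assoc]

/-- `ℓ¹(S)` with convolution and the `ℓ¹` norm is a (not necessarily unital) Banach algebra. -/
instance : NonUnitalNormedRing (L1Alg S) where
  __ := (inferInstance : NormedAddCommGroup (L1Alg S))
  mul := conv
  left_distrib := conv_add
  right_distrib := add_conv
  zero_mul f := (convL S).map_zero₂ f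
  mul_zero f := (convL S f).map_zero
  mul_assoc := conv_assoc
  norm_mul_le := norm_conv_le

theorem mul_apply (f g : L1Alg S) (s : S) :
    (f * g) s = ∑' p : {p : S × S // p.1 * p.2 = s}, f p.1.1 * g p.1.2 := rfl

instance : IsScalarTower ℂ (L1Alg S) (L1Alg S) := ⟨smul_conv⟩
instance : SMulCommClass ℂ (L1Alg S) (L1Alg S) := ⟨fun c f g => (conv_smul c f g).symm⟩

end L1Alg

/-! ## Amenable groups -/

/-- Left translation `(ℓ_g f)(x) = f (g x)` of a bounded function on a group. -/
def leftTranslate {G : Type*} [Group G] (g : G) (f : lp (fun _ : G => ℝ) ∞) : lp (fun _ : G => ℝ) ∞ :=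
  ⟨fun x => f (g * x), memℓp_infty ((lp.memℓp f).bddAbove.mono (by
    rintro _ ⟨x, rfl⟩
    exact ⟨g * x, rfl⟩))⟩

/-- A (discrete) group is amenable if there is a left invariant mean on `ℓ^∞(G)`: a positive
normalized linear functional which is invariant under left translations. -/
def AmenableGroup (G : Type*) [Group G] : Prop :=
  ∃ μ : lp (fun _ : G => ℝ) ∞ →ₗ[ℝ] ℝ,
    (∀ f, (∀ x, 0 ≤ f x) → 0 ≤ μ f) ∧ μ 1 = 1 ∧ ∀ g f, μ (leftTranslate g f) = μ f

/-! ## Inverse semigroups -/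

/-- An inverse semigroup: every `s` has a unique inverse `s⁻¹`, that is a unique element with
`s s⁻¹ s = s` and `s⁻¹ s s⁻¹ = s⁻¹`. -/
class InverseSemigroup (S : Type*) extends Semigroup S, Inv S where
  mul_inv_mul_self : ∀ s : S, s * s⁻¹ * s = s
  inv_mul_inv_self : ∀ s : S, s⁻¹ * s * s⁻¹ = s⁻¹
  inv_unique : ∀ s t : S, s * t * s = s → t * s * t = t → t = s⁻¹

namespace InverseSemigroup

variable (S : Type*) [InverseSemigroup S]

/-- The semilattice `E(S)` of idempotents, ordered by `e ≤ f ↔ e = e f = f e`, is uniformly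
locally finite: the cardinalities of the sets `{f ∈ E(S) | f ≤ e}` are bounded. -/
def IdempotentsUniformlyLocallyFinite : Prop :=
  ∃ N : ℕ, ∀ e : S, IsIdempotentElem e →
    {f : S | IsIdempotentElem f ∧ f = f * e ∧ f = e * f}.encard ≤ N

variable {S}

/-- `s 𝔇 t` if there is `x` with `s s⁻¹ = x x⁻¹` and `t⁻¹ t = x⁻¹ x`. -/
def DRel (s t : S) : Prop := ∃ x : S, s * s⁻¹ = x * x⁻¹ ∧ t⁻¹ * t = x⁻¹ * x

/-- The maximal subgroup `G_p = {s | s s⁻¹ = s⁻¹ s = p}` at an idempotent `p`. -/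
@[ext]
structure MaxSubgroup (p : {p : S // IsIdempotentElem p}) where
  val : S
  mul_inv : val * val⁻¹ = p
  inv_mul : val⁻¹ * val = p

namespace MaxSubgroup

theorem inv_inv_eq (s : S) : s⁻¹⁻¹ = s :=
  (inv_unique s⁻¹ s (inv_mul_inv_self s) (mul_inv_mul_self s)).symm

variable {p : {p : S // IsIdempotentElem p}}

theorem id_mul (s : MaxSubgroup p) : p.1 * s.val = s.val := by
  rw [← s.mul_inv, mul_inv_mul_self]

theorem mul_id (s : MaxSubgroup p) : s.val * p.1 = s.val := by
  rw [← s.inv_mul, ← mul_assoc, mul_inv_mul_self]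

theorem id_inv (p : {p : S // IsIdempotentElem p}) : (p.1)⁻¹ = p.1 := by
  have h : p.1 * p.1 * p.1 = p.1 := by rw [p.2.eq, p.2.eq]
  exact (inv_unique p.1 p.1 h h).symm

/-- The inverse in `G_p`. -/
def inv' (s : MaxSubgroup p) : MaxSubgroup p :=
  ⟨s.val⁻¹, by rw [inv_inv_eq]; exact s.inv_mul, by rw [inv_inv_eq]; exact s.mul_inv⟩

theorem mul_mul_inv (s t : MaxSubgroup p) : s.val * t.val * (t.val⁻¹ * s.val⁻¹) = p := by
  rw [mul_assoc, ← mul_assoc t.val, t.mul_inv, ← mul_assoc, mul_id, s.mul_inv]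

theorem inv_mul_mul (s t : MaxSubgroup p) : t.val⁻¹ * s.val⁻¹ * (s.val * t.val) = p := by
  rw [mul_assoc, ← mul_assoc s.val⁻¹, s.inv_mul, id_mul, t.inv_mul]

theorem mul_inv_rev' (s t : MaxSubgroup p) : (s.val * t.val)⁻¹ = t.val⁻¹ * s.val⁻¹ := by
  refine (inv_unique _ _ ?_ ?_).symm
  · rw [mul_mul_inv, ← mul_assoc, id_mul]
  · rw [inv_mul_mul, ← mul_assoc]
    congr 1
    exact id_mul (inv' t)

/-- `G_p` is a group under the multiplication of `S`, with identity `p`. -/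
instance : Group (MaxSubgroup p) where
  mul s t := ⟨s.val * t.val, by rw [mul_inv_rev']; exact mul_mul_inv s t,
    by rw [mul_inv_rev']; exact inv_mul_mul s t⟩
  one := ⟨p.1, by rw [id_inv]; exact p.2, by rw [id_inv]; exact p.2⟩
  inv := inv'
  mul_assoc s t u := MaxSubgroup.ext (mul_assoc s.val t.val u.val)
  one_mul s := MaxSubgroup.ext (id_mul s)
  mul_one s := MaxSubgroup.ext (mul_id s)
  inv_mul_cancel s := MaxSubgroup.ext s.inv_mul

end MaxSubgroup

end InverseSemigroup

end

/-! Regard `S` as a groupoid: `s` is an arrow with left end `s s⁻¹` (`lid`) and right end `s⁻¹ s`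
(`rid`), and only products with `rid s = lid t` are kept. Uniform local finiteness makes `δ_s ↦ ∑_{t
≤ s} δ_t` bounded and equal to the identity plus a nilpotent, hence an automorphism of the Banach
space `ℓ¹(S)`; it turns convolution into the groupoid product (`zeta_mul`,
`exists_groupoidTransform`). In the new basis `gbasis`, the algebra splits into one block per
`𝔇`-class, and each block behaves like matrices over `ℓ¹(G_p)` indexed by the idempotents of the
class.

Necessity. The elements `n = π**(m)` commute with the algebra, so the trace-like functionals
`arrowSum T e e` take the same value under `n` for all idempotents `e` of one class. Sums of these
functionals over finite sets of idempotents are uniformly bounded, so in an infinite class the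
common value is `0`; but along the net it must tend to `1` (`central_arrowSum_eq_zero`,
`tendsto_arrowSum`). For amenability, bounded functions on `G_p` are pulled back to functionals on
the tensor square so that the left action becomes translation and the right action becomes trivial
(`adj_lactSq_meanForm`, `adj_ractSq_meanForm`). The net then gives functionals on `ℓ^∞(G_p)` that
are asymptotically invariant in norm, possibly unbounded; normalizing their total variations and
taking an ultrafilter limit yields a mean (`amenableGroup_of_net`).

Sufficiency. Choose a representative `p` of each class, and for each idempotent `e` an arrow `x`
between `p` and `e`. Averaging `x⁻¹ h ⊗ h⁻¹ x` over `h ∈ G_p` with an invariant mean gives an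
element of the bidual, and summing over a finite union of classes gives an exactly central diagonal
(`biadj_diagonal`) whose product is a central local unit. Finiteness of the classes makes these
local units an approximate identity (`tendsto_mul_localUnit`). -/

namespace InverseSemigroup

/-! ### Commuting idempotents and the ends of an arrow -/

variable {S : Type*} [InverseSemigroup S]

theorem inv_eq_self {e : S} (he : IsIdempotentElem e) : e⁻¹ = e :=
  MaxSubgroup.id_inv ⟨e, he⟩

theorem inv_inv' (s : S) : s⁻¹⁻¹ = s := MaxSubgroup.inv_inv_eq s

theorem isIdempotentElem_mul_inv (s : S) : IsIdempotentElem (s * s⁻¹) := by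
  rw [IsIdempotentElem, ← mul_assoc, mul_inv_mul_self]

theorem isIdempotentElem_inv_mul (s : S) : IsIdempotentElem (s⁻¹ * s) := by
  rw [IsIdempotentElem, ← mul_assoc, inv_mul_inv_self]

theorem mul_inv_mul_cancel (s t : S) : s * (s⁻¹ * (s * t)) = s * t := by
  rw [← mul_assoc, ← mul_assoc, mul_inv_mul_self]

theorem inv_mul_inv_cancel (s t : S) : s⁻¹ * (s * (s⁻¹ * t)) = s⁻¹ * t := by
  rw [← mul_assoc, ← mul_assoc, inv_mul_inv_self]

/-- If `x` is the inverse of `e f`, then `f x e` is another one, so `x = f x e`. This makes `x`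
idempotent, hence its own inverse, and so equal to `e f`. -/
theorem isIdempotentElem_mul {e f : S} (he : IsIdempotentElem e) (hf : IsIdempotentElem f) :
    IsIdempotentElem (e * f) := by
  have h₁ := mul_inv_mul_self (e * f)
  have h₂ := inv_mul_inv_self (e * f)
  set x := (e * f)⁻¹ with hx
  have he' : ∀ y, e * (e * y) = e * y := fun y => by rw [← mul_assoc, he.eq]
  have hf' : ∀ y, f * (f * y) = f * y := fun y => by rw [← mul_assoc, hf.eq]
  simp only [mul_assoc] at h₁ h₂
  have h₂' : ∀ y, x * (e * (f * (x * y))) = x * y := fun y => by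
    simpa only [mul_assoc] using congrArg (· * y) h₂
  have h₃ : f * x * e = x := by
    refine inv_unique _ _ ?_ ?_
    · simp only [mul_assoc, he', hf', h₁]
    · simp only [mul_assoc, he', hf', h₂']
  have h₄ : IsIdempotentElem x := by
    calc x * x = f * x * e * (f * x * e) := by rw [h₃]
      _ = f * x * e := by simp only [mul_assoc, h₂']
      _ = x := h₃
  have h₅ : x = e * f := by rw [← inv_eq_self h₄, hx, inv_inv']
  rwa [← h₅]

/-- Both `e f`, being idempotent, and `f e` are inverses of `e f`; uniqueness identifies them. -/
theorem idem_comm {e f : S} (he : IsIdempotentElem e) (hf : IsIdempotentElem f) :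
    e * f = f * e := by
  have h₁ := isIdempotentElem_mul he hf
  have h₂ := isIdempotentElem_mul hf he
  rw [← inv_eq_self h₁]
  have he' : ∀ y, e * (e * y) = e * y := fun y => by rw [← mul_assoc, he.eq]
  have hf' : ∀ y, f * (f * y) = f * y := fun y => by rw [← mul_assoc, hf.eq]
  refine (inv_unique _ _ ?_ ?_).symm
  · simpa only [mul_assoc, he', hf', IsIdempotentElem] using h₁
  · simpa only [mul_assoc, he', hf', IsIdempotentElem] using h₂

theorem mul_inv_rev' (s t : S) : (s * t)⁻¹ = t⁻¹ * s⁻¹ := by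
  have h := idem_comm (isIdempotentElem_inv_mul s) (isIdempotentElem_mul_inv t)
  refine (inv_unique _ _ ?_ ?_).symm
  · calc s * t * (t⁻¹ * s⁻¹) * (s * t) = s * (t * t⁻¹ * (s⁻¹ * s)) * t := by simp only [mul_assoc]
      _ = s * t := by
        rw [← h]
        simp only [mul_assoc, mul_inv_mul_cancel]
        rw [← mul_assoc t, mul_inv_mul_self]
  · calc t⁻¹ * s⁻¹ * (s * t) * (t⁻¹ * s⁻¹) = t⁻¹ * (s⁻¹ * s * (t * t⁻¹)) * s⁻¹ := by
          simp only [mul_assoc]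
      _ = t⁻¹ * s⁻¹ := by
        rw [h]
        simp only [mul_assoc, inv_mul_inv_cancel]
        rw [← mul_assoc s⁻¹, inv_mul_inv_self]

/-- The idempotent `s s⁻¹`, the identity on the left of `s`. -/
def lid (s : S) : S := s * s⁻¹

/-- The idempotent `s⁻¹ s`, the identity on the right of `s`. -/
def rid (s : S) : S := s⁻¹ * s

theorem idem_lid (s : S) : IsIdempotentElem (lid s) := isIdempotentElem_mul_inv s
theorem idem_rid (s : S) : IsIdempotentElem (rid s) := isIdempotentElem_inv_mul s

theorem lid_mul (s : S) : lid s * s = s := mul_inv_mul_self s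
theorem mul_rid (s : S) : s * rid s = s := by rw [rid, ← mul_assoc, mul_inv_mul_self]

theorem lid_inv (s : S) : lid s⁻¹ = rid s := by rw [lid, rid, inv_inv']
theorem rid_inv (s : S) : rid s⁻¹ = lid s := by rw [lid, rid, inv_inv']

theorem lid_idem {e : S} (he : IsIdempotentElem e) : lid e = e := by
  rw [lid, inv_eq_self he, he.eq]
theorem rid_idem {e : S} (he : IsIdempotentElem e) : rid e = e := by
  rw [rid, inv_eq_self he, he.eq]

theorem lid_mul_eq (s t : S) : lid (s * t) = s * lid t * s⁻¹ := by
  simp only [lid, mul_inv_rev', mul_assoc]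
theorem rid_mul_eq (s t : S) : rid (s * t) = t⁻¹ * rid s * t := by
  simp only [rid, mul_inv_rev', mul_assoc]

theorem lid_mul_of_eq {s t : S} (h : rid s = lid t) : lid (s * t) = lid s := by
  rw [lid_mul_eq, ← h, mul_rid, lid]

theorem rid_mul_of_eq {s t : S} (h : rid s = lid t) : rid (s * t) = rid t := by
  rw [rid_mul_eq, h, mul_assoc, lid_mul, rid]

/-! ### The natural partial order -/

/-- The natural partial order: `t` is a restriction of `s`. -/
def Below (t s : S) : Prop := t = s * rid t

theorem below_iff_exists {t s : S} : Below t s ↔ ∃ e, IsIdempotentElem e ∧ t = s * e := by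
  refine ⟨fun h => ⟨_, idem_rid t, h⟩, ?_⟩
  rintro ⟨e, he, rfl⟩
  rw [Below, rid_mul_eq, inv_eq_self he, mul_assoc, ← mul_assoc e, idem_comm he (idem_rid s),
    mul_assoc, he.eq, ← mul_assoc, mul_rid]

theorem below_iff_exists' {t s : S} : Below t s ↔ ∃ e, IsIdempotentElem e ∧ t = e * s := by
  rw [below_iff_exists]
  constructor
  · rintro ⟨e, he, rfl⟩
    refine ⟨lid (s * e), idem_lid _, ?_⟩
    rw [lid_mul_eq, lid_idem he, mul_assoc, ← rid, mul_assoc, idem_comm he (idem_rid s),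
      ← mul_assoc, mul_rid]
  · rintro ⟨e, he, rfl⟩
    refine ⟨rid (e * s), idem_rid _, ?_⟩
    rw [rid_mul_eq, rid_idem he, ← mul_assoc, ← mul_assoc, ← lid, idem_comm (idem_lid s) he,
      mul_assoc, lid_mul]

theorem below_iff_lid {t s : S} : Below t s ↔ t = lid t * s := by
  refine ⟨fun h => ?_, fun h => below_iff_exists'.2 ⟨_, idem_lid t, h⟩⟩
  obtain ⟨e, he, h⟩ := below_iff_exists'.1 h
  rw [h, lid_mul_eq, inv_eq_self he, idem_comm he (idem_lid s), mul_assoc (lid s), he.eq,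
    idem_comm (idem_lid s) he, mul_assoc, lid_mul]

theorem Below.refl (s : S) : Below s s := (mul_rid s).symm

theorem Below.trans {s t u : S} (h₁ : Below s t) (h₂ : Below t u) : Below s u := by
  obtain ⟨e, he, rfl⟩ := below_iff_exists.1 h₁
  obtain ⟨f, hf, rfl⟩ := below_iff_exists.1 h₂
  exact below_iff_exists.2 ⟨f * e, isIdempotentElem_mul hf he, mul_assoc _ _ _⟩

theorem Below.antisymm {s t : S} (h₁ : Below s t) (h₂ : Below t s) : s = t := by
  have h : s = t * rid s := h₁
  rw [h₂, mul_assoc, idem_comm (idem_rid t) (idem_rid s), ← mul_assoc, mul_rid] at h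
  exact h.trans h₂.symm

theorem Below.mul {s t s' t' : S} (h₁ : Below s' s) (h₂ : Below t' t) :
    Below (s' * t') (s * t) := by
  have h₃ : Below (s' * t') (s * t') := by
    obtain ⟨e, he, rfl⟩ := below_iff_exists'.1 h₁
    exact below_iff_exists'.2 ⟨e, he, mul_assoc _ _ _⟩
  refine h₃.trans ?_
  obtain ⟨e, he, rfl⟩ := below_iff_exists.1 h₂
  exact below_iff_exists.2 ⟨e, he, (mul_assoc _ _ _).symm⟩

/-- A restriction of `u` is determined by either of its ends. This gives injectivity in `zeta_mul`
and the counting bound in `encard_below_le`. -/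
theorem Below.eq_of_lid_eq {s t u : S} (h₁ : Below s u) (h₂ : Below t u) (h : lid s = lid t) :
    s = t := by
  rw [below_iff_lid.1 h₁, below_iff_lid.1 h₂, h]

theorem Below.eq_of_rid_eq {s t u : S} (h₁ : Below s u) (h₂ : Below t u) (h : rid s = rid t) :
    s = t := by
  rw [h₁, h₂, h]

theorem Below.rid_mul_rid {t s : S} (h : Below t s) : rid t * rid s = rid t := by
  have h' := congrArg rid (show t = s * rid t from h)
  rw [rid_mul_eq, inv_eq_self (idem_rid t), mul_assoc, idem_comm (idem_rid s) (idem_rid t),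
    ← mul_assoc, (idem_rid t).eq] at h'
  exact h'.symm

/-- Restrict `s` on the left to the left end of `u`, and `t` on the right to its right end: the two
pieces meet in the middle and compose to `u`. This is the surjectivity needed for `zeta_mul`. -/
theorem Below.exists_factor {s t u : S} (h : Below u (s * t)) :
    ∃ s' t', Below s' s ∧ Below t' t ∧ rid s' = lid t' ∧ s' * t' = u := by
  refine ⟨lid u * s, t * rid u, below_iff_exists'.2 ⟨_, idem_lid u, rfl⟩,
    below_iff_exists.2 ⟨_, idem_rid u, rfl⟩, ?_, ?_⟩
  · have hr : rid u * rid (s * t) = rid u := h.rid_mul_rid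
    -- The common middle idempotent is `t (rid u) t⁻¹`. It is `lid t'` directly; for it to be `rid
    -- s'` as well it must lie below `rid s`, which is `h₃`.
    have h₁ : lid u = s * (t * rid u * t⁻¹) * s⁻¹ := by
      nth_rw 1 [show u = s * t * rid u from h]
      rw [lid_mul_eq, lid_idem (idem_rid u), mul_inv_rev']
      simp only [mul_assoc]
    have h₂ : IsIdempotentElem (t * rid u * t⁻¹) := by
      have := idem_lid (t * rid u)
      rwa [lid_mul_eq, lid_idem (idem_rid u)] at this
    have h₃ : t * rid u * t⁻¹ * rid s = t * rid u * t⁻¹ := by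
      nth_rw 2 [← hr]
      rw [rid_mul_eq]
      have : t * (rid u * (t⁻¹ * rid s * t)) * t⁻¹ = t * rid u * t⁻¹ * (rid s * lid t) := by
        simp only [lid, mul_assoc]
      rw [this, idem_comm (idem_rid s) (idem_lid t), ← mul_assoc, lid]
      congr 1
      simp only [mul_assoc]
      rw [← mul_assoc t⁻¹ t, inv_mul_inv_self]
    rw [rid_mul_eq, lid_mul_eq, rid_idem (idem_lid u), lid_idem (idem_rid u), h₁]
    have : s⁻¹ * (s * (t * rid u * t⁻¹) * s⁻¹) * s = rid s * (t * rid u * t⁻¹ * rid s) := by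
      simp only [rid, mul_assoc]
    rw [this, h₃, idem_comm (idem_rid s) h₂, h₃]
  · rw [mul_assoc, ← mul_assoc s, ← show u = s * t * rid u from h, lid_mul]

end InverseSemigroup

/-! ### Bounded operators on the projective tensor square -/

noncomputable section

namespace BanachAlg

section BidualNorm

variable {X : Type*} [NormedAddCommGroup X] [NormedSpace ℂ X]

/-- The norm of a bidual. -/
def bidualNorm (m : StrongDual ℂ (StrongDual ℂ X)) : ℝ := ‖m‖

theorem bidualNorm_nonneg (m : StrongDual ℂ (StrongDual ℂ X)) : 0 ≤ bidualNorm m :=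
  norm_nonneg m

theorem norm_apply_le_bidualNorm (m : StrongDual ℂ (StrongDual ℂ X)) (f : StrongDual ℂ X) :
    ‖m f‖ ≤ bidualNorm m * ‖f‖ :=
  m.le_opNorm f

theorem tendsto_bidualNorm_zero {ι : Type*} {l : Filter ι}
    {m : ι → StrongDual ℂ (StrongDual ℂ X)} (h : Tendsto m l (𝓝 0)) :
    Tendsto (fun i => bidualNorm (m i)) l (𝓝 0) := by
  have h' := ((continuous_norm (E := StrongDual ℂ (StrongDual ℂ X))).tendsto 0).comp h
  have h₀ : ‖(0 : StrongDual ℂ (StrongDual ℂ X))‖ = 0 := ContinuousLinearMap.opNorm_zero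
  refine Eq.mp ?_ h'
  rw [h₀]
  rfl

end BidualNorm

section LiftSq

variable {A : Type*} [NonUnitalNormedRing A] [NormedSpace ℂ A]
variable {F : Type*} [NormedAddCommGroup F] [NormedSpace ℂ F]

/-- A bounded bilinear map as a bounded multilinear map of two variables. -/
def bilinMultilinear (B : A →L[ℂ] A →L[ℂ] F) :
    ContinuousMultilinearMap ℂ (fun _ : Fin 2 => A) F :=
  MultilinearMap.mkContinuous
    { toFun := fun v => B (v 0) (v 1)
      map_update_add' := by
        intro _ v i x y
        fin_cases i <;> simp [Function.update]
      map_update_smul' := by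
        intro _ v i c x
        fin_cases i <;> simp [Function.update] }
    ‖B‖ (fun v => by simpa [Fin.prod_univ_two, mul_assoc] using B.le_opNorm₂ (v 0) (v 1))

theorem norm_bilinMultilinear_le (B : A →L[ℂ] A →L[ℂ] F) : ‖bilinMultilinear B‖ ≤ ‖B‖ :=
  MultilinearMap.mkContinuous_norm_le _ B.opNorm_nonneg _

variable [CompleteSpace F]

/-- The linearization on `A ⊗ₚ A` of a bounded bilinear map. -/
def liftSq (B : A →L[ℂ] A →L[ℂ] F) : ProjSq A →L[ℂ] F :=
  (PiTensorProduct.liftIsometry ℂ (fun _ : Fin 2 => A) F (bilinMultilinear B)).extend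
    (UniformSpace.Completion.toComplL (𝕜 := ℂ) (E := ⨂[ℂ] _ : Fin 2, A))

theorem liftSq_coe (B : A →L[ℂ] A →L[ℂ] F) (x : ⨂[ℂ] _ : Fin 2, A) :
    liftSq B (x : ProjSq A) =
      PiTensorProduct.liftIsometry ℂ (fun _ : Fin 2 => A) F (bilinMultilinear B) x :=
  ContinuousLinearMap.extend_eq
    (PiTensorProduct.liftIsometry ℂ (fun _ : Fin 2 => A) F (bilinMultilinear B))
    (e := UniformSpace.Completion.toComplL (𝕜 := ℂ) (E := ⨂[ℂ] _ : Fin 2, A))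
    UniformSpace.Completion.denseRange_coe
    (UniformSpace.Completion.isUniformInducing_coe _) x

theorem liftSq_tmul (B : A →L[ℂ] A →L[ℂ] F) (a b : A) : liftSq B (tmul a b) = B a b := by
  rw [tmul, liftSq_coe, PiTensorProduct.liftIsometry_apply_apply, PiTensorProduct.lift.tprod]
  rfl

theorem norm_liftSq_le (B : A →L[ℂ] A →L[ℂ] F) : ‖liftSq B‖ ≤ ‖B‖ := by
  refine ContinuousLinearMap.opNorm_le_bound _ B.opNorm_nonneg fun x => ?_
  induction x using UniformSpace.Completion.induction_on with
  | hp => exact isClosed_le (by fun_prop) (by fun_prop)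
  | ih x =>
    rw [liftSq_coe, UniformSpace.Completion.norm_coe]
    refine (ContinuousLinearMap.le_opNorm _ x).trans ?_
    rw [LinearIsometryEquiv.norm_map]
    exact mul_le_mul_of_nonneg_right (norm_bilinMultilinear_le B) (norm_nonneg _)

end LiftSq

section Tmul

variable {A : Type*} [NonUnitalNormedRing A] [NormedSpace ℂ A]
variable {F : Type*} [NormedAddCommGroup F] [NormedSpace ℂ F]

/-- Elementary tensors span a dense subspace. -/
theorem ext_tmul {T U : ProjSq A →L[ℂ] F} (h : ∀ a b, T (tmul a b) = U (tmul a b)) : T = U := by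
  ext x
  induction x using UniformSpace.Completion.induction_on with
  | hp => exact isClosed_eq (by fun_prop) (by fun_prop)
  | ih x =>
    induction x using PiTensorProduct.induction_on with
    | smul_tprod r f =>
      have hf : f = ![f 0, f 1] := by ext i; fin_cases i <;> rfl
      rw [UniformSpace.Completion.coe_smul, map_smul, map_smul, hf]
      exact congrArg (r • ·) (h (f 0) (f 1))
    | add x y hx hy => rw [UniformSpace.Completion.coe_add, map_add, map_add, hx, hy]

theorem norm_tmul_le (a b : A) : ‖tmul a b‖ ≤ ‖a‖ * ‖b‖ := by
  rw [tmul, UniformSpace.Completion.norm_coe]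
  refine (PiTensorProduct.projectiveSeminorm_tprod_le _).trans ?_
  simp [Fin.prod_univ_two]

theorem update_pair_zero {A : Type*} (a b x : A) : Function.update ![a, b] 0 x = ![x, b] := by
  ext i; fin_cases i <;> rfl

theorem update_pair_one {A : Type*} (a b x : A) : Function.update ![a, b] 1 x = ![a, x] := by
  ext i; fin_cases i <;> rfl

theorem tmul_add_left (a a' b : A) : tmul (a + a') b = tmul a b + tmul a' b := by
  have := (PiTensorProduct.tprod ℂ (s := fun _ : Fin 2 => A)).map_update_add ![a, b] 0 a a'
  simp only [update_pair_zero] at this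
  rw [tmul, this, UniformSpace.Completion.coe_add]
  rfl

theorem tmul_add_right (a b b' : A) : tmul a (b + b') = tmul a b + tmul a b' := by
  have := (PiTensorProduct.tprod ℂ (s := fun _ : Fin 2 => A)).map_update_add ![a, b] 1 b b'
  simp only [update_pair_one] at this
  rw [tmul, this, UniformSpace.Completion.coe_add]
  rfl

theorem tmul_smul_left (c : ℂ) (a b : A) : tmul (c • a) b = c • tmul a b := by
  have := (PiTensorProduct.tprod ℂ (s := fun _ : Fin 2 => A)).map_update_smul ![a, b] 0 c a
  simp only [update_pair_zero] at this
  rw [tmul, this, UniformSpace.Completion.coe_smul]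
  rfl

theorem tmul_smul_right (c : ℂ) (a b : A) : tmul a (c • b) = c • tmul a b := by
  have := (PiTensorProduct.tprod ℂ (s := fun _ : Fin 2 => A)).map_update_smul ![a, b] 1 c b
  simp only [update_pair_one] at this
  rw [tmul, this, UniformSpace.Completion.coe_smul]
  rfl

variable (A) in
/-- The elementary tensor as a bounded bilinear map. -/
def tmulL : A →L[ℂ] A →L[ℂ] ProjSq A :=
  LinearMap.mkContinuous₂
    (LinearMap.mk₂ ℂ tmul tmul_add_left tmul_smul_left tmul_add_right tmul_smul_right) 1
    (fun a b => by simpa using norm_tmul_le a b)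

theorem tmulL_apply (a b : A) : tmulL A a b = tmul a b := rfl

theorem norm_mapSq_le (T₀ T₁ : A →L[ℂ] A) : ‖mapSq T₀ T₁‖ ≤ ‖T₀‖ * ‖T₁‖ := by
  refine ContinuousLinearMap.opNorm_le_bound _ (by positivity) fun x => ?_
  induction x using UniformSpace.Completion.induction_on with
  | hp => exact isClosed_le (by fun_prop) (by fun_prop)
  | ih x =>
    rw [mapSq, ContinuousLinearMap.completion_apply_coe, UniformSpace.Completion.norm_coe,
      UniformSpace.Completion.norm_coe]
    refine (ContinuousLinearMap.le_opNorm _ x).trans ?_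
    refine mul_le_mul_of_nonneg_right ?_ (norm_nonneg _)
    refine (PiTensorProduct.opNorm_mapL _).trans ?_
    simp [Fin.prod_univ_two]

variable [IsScalarTower ℂ A A] [SMulCommClass ℂ A A]

theorem lactSq_add (a b : A) : lactSq (a + b) = lactSq a + lactSq b :=
  ext_tmul fun x y => by
    rw [add_apply, lactSq_tmul, lactSq_tmul, lactSq_tmul, add_mul, tmul_add_left]

theorem lactSq_smul (c : ℂ) (a : A) : lactSq (c • a) = c • lactSq a :=
  ext_tmul fun x y => by
    rw [smul_apply, lactSq_tmul, lactSq_tmul, smul_mul_assoc, tmul_smul_left]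

theorem norm_lactSq_le (a : A) : ‖lactSq a‖ ≤ 1 * ‖a‖ := by
  rw [one_mul]
  refine (norm_mapSq_le _ _).trans ?_
  refine (mul_le_of_le_one_right (norm_nonneg _) ContinuousLinearMap.norm_id_le).trans ?_
  exact ContinuousLinearMap.opNorm_mul_apply_le ℂ A a

variable (A) in
/-- The left action on `A ⊗ₚ A` as a bounded linear map. -/
def lactL : A →L[ℂ] ProjSq A →L[ℂ] ProjSq A :=
  LinearMap.mkContinuous (E := A) (F := ProjSq A →L[ℂ] ProjSq A) (σ := RingHom.id ℂ)
    { toFun := lactSq, map_add' := lactSq_add, map_smul' := lactSq_smul } 1 norm_lactSq_le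

theorem ractSq_add (a b : A) : ractSq (a + b) = ractSq a + ractSq b :=
  ext_tmul fun x y => by
    rw [add_apply, ractSq_tmul, ractSq_tmul, ractSq_tmul, mul_add, tmul_add_right]

theorem ractSq_smul (c : ℂ) (a : A) : ractSq (c • a) = c • ractSq a :=
  ext_tmul fun x y => by
    rw [smul_apply, ractSq_tmul, ractSq_tmul, mul_smul_comm, tmul_smul_right]

theorem norm_ractSq_le (a : A) : ‖ractSq a‖ ≤ 1 * ‖a‖ := by
  rw [one_mul]
  refine (norm_mapSq_le _ _).trans ?_
  refine (mul_le_of_le_one_left (norm_nonneg _) ContinuousLinearMap.norm_id_le).trans ?_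
  refine ContinuousLinearMap.opNorm_le_bound _ (norm_nonneg _) fun x => ?_
  rw [mul_comm]
  exact norm_mul_le x a

variable (A) in
/-- The right action on `A ⊗ₚ A` as a bounded linear map. -/
def ractL : A →L[ℂ] ProjSq A →L[ℂ] ProjSq A :=
  LinearMap.mkContinuous (E := A) (F := ProjSq A →L[ℂ] ProjSq A) (σ := RingHom.id ℂ)
    { toFun := ractSq, map_add' := ractSq_add, map_smul' := ractSq_smul } 1 norm_ractSq_le

end Tmul

end BanachAlg

/-! ### Operators on `ℓ¹(S)` determined by point masses -/

namespace L1Alg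

variable {S : Type*} {F : Type*} [NormedAddCommGroup F] [NormedSpace ℂ F]

theorem norm_single (s : S) (a : ℂ) : ‖single s a‖ = ‖a‖ := by
  classical
  exact lp.norm_single (E := fun _ : S => ℂ) (by simp) s a

theorem single_eq_smul (s : S) (a : ℂ) : single s a = a • single s 1 := by
  classical
  refine ext' fun t => ?_
  change _ = a * (single s 1 : L1Alg S) t
  simp [single_apply]

theorem hasSum_single (f : L1Alg S) : HasSum (fun s => f s • single s 1) f := by
  classical
  have := lp.hasSum_single (E := fun _ : S => ℂ) (p := 1) (by simp) f
  refine Eq.mp ?_ this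
  congr 1
  funext s
  exact single_eq_smul s _

theorem ext_single {T U : L1Alg S →L[ℂ] F} (h : ∀ s, T (single s 1) = U (single s 1)) : T = U :=
  ContinuousLinearMap.ext fun f => ext_clm (fun s a => by
    rw [single_eq_smul, map_smul, map_smul, h]) f

variable [CompleteSpace F]

theorem summable_smul {v : S → F} {C : ℝ} (hv : ∀ s, ‖v s‖ ≤ C) (f : L1Alg S) :
    Summable fun s => f s • v s := by
  refine .of_norm_bounded (f.hasSum_norm.summable.mul_right C) fun s => ?_
  rw [norm_smul]
  exact mul_le_mul_of_nonneg_left (hv s) (norm_nonneg _)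

/-- The bounded operator on `ℓ¹(S)` which sends the point masses to a bounded family. -/
def lift (v : S → F) (C : ℝ) (hv : ∀ s, ‖v s‖ ≤ C) : L1Alg S →L[ℂ] F :=
  LinearMap.mkContinuous
    { toFun := fun f => ∑' s, f s • v s
      map_add' := fun f g => by
        rw [← (summable_smul hv f).tsum_add (summable_smul hv g)]
        exact tsum_congr fun s => add_smul (f s) (g s) (v s)
      map_smul' := fun c f => by
        rw [RingHom.id_apply, ← tsum_const_smul'']
        exact tsum_congr fun s => mul_smul c (f s) (v s) }
    C fun f => by
      rw [mul_comm]
      refine tsum_of_norm_bounded (f.hasSum_norm.mul_right C) fun s => ?_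
      rw [norm_smul]
      exact mul_le_mul_of_nonneg_left (hv s) (norm_nonneg _)

theorem lift_apply (v : S → F) (C : ℝ) (hv : ∀ s, ‖v s‖ ≤ C) (f : L1Alg S) :
    lift v C hv f = ∑' s, f s • v s := rfl

theorem lift_single (v : S → F) (C : ℝ) (hv : ∀ s, ‖v s‖ ≤ C) (s : S) :
    lift v C hv (single s 1) = v s := by
  rw [lift_apply, tsum_eq_single s]
  · simp [single_apply]
  · intro t ht
    simp [single_apply, ht]

theorem norm_lift_le (v : S → F) (C : ℝ) (hv : ∀ s, ‖v s‖ ≤ C) (hC : 0 ≤ C) :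
    ‖lift v C hv‖ ≤ C :=
  LinearMap.mkContinuous_norm_le _ hC _

theorem single_mul_single [Semigroup S] (s t : S) :
    (single s 1 * single t 1 : L1Alg S) = single (s * t) 1 := by
  have := conv_single s t 1 1
  rw [mul_one] at this
  exact this

end L1Alg

/-! ### From convolution to the groupoid product -/

namespace InverseSemigroup

open L1Alg

variable {S : Type*} [InverseSemigroup S]

/-- A restriction of `s` is determined by its right end, an idempotent below `rid s`; so the bound
on `E(S)` also bounds the down-sets of all of `S`. -/
theorem encard_below_le (s : S) : {t | Below t s}.encard ≤
    {f : S | IsIdempotentElem f ∧ f = f * rid s ∧ f = rid s * f}.encard := by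
  refine Set.encard_le_encard_of_injOn (f := rid) (fun t ht => ⟨idem_rid t, ?_, ?_⟩) ?_
  · exact (Below.rid_mul_rid ht).symm
  · rw [idem_comm (idem_rid s) (idem_rid t)]
    exact (Below.rid_mul_rid ht).symm
  · intro t ht u hu h
    exact Below.eq_of_rid_eq ht hu h

/-- The elements below `s` for the natural partial order. -/
def lower (hfin : ∀ s : S, {t | Below t s}.Finite) (s : S) : Finset S := (hfin s).toFinset

variable {hfin : ∀ s : S, {t | Below t s}.Finite}

theorem mem_lower {s t : S} : t ∈ lower hfin s ↔ Below t s := by simp [lower]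

theorem self_mem_lower (s : S) : s ∈ lower hfin s := mem_lower.2 (Below.refl s)

theorem lower_card_lt {s t : S} (h : Below t s) (hne : t ≠ s) :
    (lower hfin t).card < (lower hfin s).card := by
  refine Finset.card_lt_card ⟨fun u hu => mem_lower.2 ((mem_lower.1 hu).trans h), fun hs => ?_⟩
  exact hne (h.antisymm (mem_lower.1 (hs (self_mem_lower s))))

theorem norm_sum_lower_le {N : ℕ} (hN : ∀ s, (lower hfin s).card ≤ N) (s : S) :
    ‖∑ t ∈ lower hfin s, (single t 1 : L1Alg S)‖ ≤ N := by
  refine (norm_sum_le _ _).trans ?_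
  simpa [norm_single] using hN s

/-- The operator `δ_s ↦ ∑_{t ≤ s} δ_t`. -/
def zeta {N : ℕ} (hN : ∀ s, (lower hfin s).card ≤ N) : L1Alg S →L[ℂ] L1Alg S :=
  lift (fun s => ∑ t ∈ lower hfin s, single t 1) N (norm_sum_lower_le hN)

variable {N : ℕ} (hN : ∀ s, (lower hfin s).card ≤ N)

theorem zeta_single (s : S) : zeta hN (single s 1) = ∑ t ∈ lower hfin s, single t 1 :=
  lift_single _ _ _ s

open scoped Classical in
theorem zeta_sub_one_single (s : S) :
    (zeta hN - 1) (single s 1) = ∑ t ∈ (lower hfin s).erase s, single t 1 := by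
  rw [sub_apply, zeta_single, ← Finset.add_sum_erase _ _ (self_mem_lower s)]
  exact add_sub_cancel_left _ _

/-- Subtracting the identity leaves only elements strictly below `s`, and each of these has strictly
fewer elements below it; the powers run out after as many steps as `s` has lower elements. -/
theorem pow_zeta_sub_one_single (n : ℕ) (s : S) (h : (lower hfin s).card ≤ n) :
    ((zeta hN - 1) ^ n) (single s 1) = 0 := by
  classical
  induction n generalizing s with
  | zero =>
    rw [Nat.le_zero, Finset.card_eq_zero] at h
    exact absurd (self_mem_lower (hfin := hfin) s) (by simp [h])
  | succ n ih =>
    rw [pow_succ, mul_apply_eq_comp, zeta_sub_one_single, map_sum]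
    refine Finset.sum_eq_zero fun t ht => ih t ?_
    rw [Finset.mem_erase, mem_lower] at ht
    exact Nat.le_of_lt_succ ((lower_card_lt ht.2 ht.1).trans_le h)

/-- The uniform bound `N` is one nilpotency exponent valid at all point masses at once. -/
theorem isUnit_zeta : IsUnit (zeta hN) := by
  have h : IsNilpotent (zeta hN - 1) := ⟨N, ext_single fun s => by
    rw [pow_zeta_sub_one_single hN N s (hN s)]; rfl⟩
  simpa using h.isUnit_add_one

open scoped Classical in
theorem norm_ite_single_le (p : Prop) (s : S) :
    ‖if p then (single s 1 : L1Alg S) else 0‖ ≤ 1 := by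
  split_ifs <;> simp [norm_single]

open scoped Classical in
variable (S) in
/-- The convolution product of the groupoid of `S`: only the products `s t` with
`s⁻¹ s = t t⁻¹` are kept. -/
def groupoidMul : L1Alg S →L[ℂ] L1Alg S →L[ℂ] L1Alg S :=
  lift (fun s => lift (fun t => if rid s = lid t then single (s * t) 1 else 0) 1
      fun _ => norm_ite_single_le _ _) 1
    fun _ => norm_lift_le _ _ _ zero_le_one

open scoped Classical in
theorem groupoidMul_single (s t : S) :
    groupoidMul S (single s 1) (single t 1) = if rid s = lid t then single (s * t) 1 else 0 := by
  rw [groupoidMul, lift_single, lift_single]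

/-- By continuity it suffices to treat point masses, where the claim is a bijection `(s', t') ↦ s'
t'` from composable pairs with `s' ≤ s`, `t' ≤ t` onto the elements below `s t`. -/
theorem zeta_mul (a b : L1Alg S) : zeta hN (a * b) = groupoidMul S (zeta hN a) (zeta hN b) := by
  classical
  let P : L1Alg S →L[ℂ] L1Alg S →L[ℂ] L1Alg S :=
    (ContinuousLinearMap.compL ℂ _ _ _ (zeta hN)).comp (ContinuousLinearMap.mul ℂ (L1Alg S))
  let Q : L1Alg S →L[ℂ] L1Alg S →L[ℂ] L1Alg S :=
    ((groupoidMul S).comp (zeta hN)).flip.comp (zeta hN) |>.flip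
  suffices h : P = Q from DFunLike.congr_fun (DFunLike.congr_fun h a) b
  refine ext_single fun s => ext_single fun t => ?_
  change zeta hN (single s 1 * single t 1) =
    groupoidMul S (zeta hN (single s 1)) (zeta hN (single t 1))
  simp only [single_mul_single, zeta_single, map_sum, sum_apply, groupoidMul_single]
  rw [Finset.sum_comm, ← Finset.sum_product', ← Finset.sum_filter]
  symm
  refine Finset.sum_bij (fun x _ => x.1 * x.2) ?_ ?_ ?_ fun _ _ => rfl
  · intro x hx
    simp only [Finset.mem_filter, Finset.mem_product, mem_lower] at hx ⊢
    exact hx.1.1.mul hx.1.2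
  · intro x hx y hy h
    simp only [Finset.mem_filter, Finset.mem_product, mem_lower] at hx hy
    -- The product of a composable pair remembers the left end of the first factor and the right end
    -- of the second, and these determine the two restrictions.
    refine Prod.ext (hx.1.1.eq_of_lid_eq hy.1.1 ?_) (hx.1.2.eq_of_rid_eq hy.1.2 ?_)
    · rw [← lid_mul_of_eq hx.2, ← lid_mul_of_eq hy.2, h]
    · rw [← rid_mul_of_eq hx.2, ← rid_mul_of_eq hy.2, h]
  · intro u hu
    obtain ⟨s', t', h₁, h₂, h₃, rfl⟩ := (mem_lower.1 hu).exists_factor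
    refine ⟨(s', t'), ?_, rfl⟩
    simp only [Finset.mem_filter, Finset.mem_product, mem_lower]
    exact ⟨⟨h₁, h₂⟩, h₃⟩

open scoped Classical in
/-- A Banach space automorphism of `ℓ¹(S)` that carries convolution to the product of the groupoid
of `S`. -/
def IsGroupoidTransform (T : L1Alg S ≃L[ℂ] L1Alg S) : Prop :=
  ∀ s t : S, T.symm (single s 1) * T.symm (single t 1) =
    if rid s = lid t then T.symm (single (s * t) 1) else 0

theorem exists_groupoidTransform (hS : IdempotentsUniformlyLocallyFinite S) :
    ∃ T : L1Alg S ≃L[ℂ] L1Alg S, IsGroupoidTransform T := by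
  classical
  obtain ⟨N, hN⟩ := hS
  have hle : ∀ s : S, {t | Below t s}.encard ≤ N :=
    fun s => (encard_below_le s).trans (hN _ (idem_rid s))
  have hfin : ∀ s : S, {t | Below t s}.Finite := fun s => Set.finite_of_encard_le_coe (hle s)
  have hcard : ∀ s, (lower hfin s).card ≤ N := fun s => by
    have := hle s
    rw [(hfin s).encard_eq_coe_toFinset_card] at this
    exact_mod_cast this
  obtain ⟨u, hu⟩ := isUnit_zeta hcard
  let T := ContinuousLinearEquiv.unitsEquiv ℂ (L1Alg S) u
  have hT : ∀ a, T a = zeta hcard a := fun a => by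
    rw [← hu]; rfl
  refine ⟨T, fun s t => T.injective ?_⟩
  rw [hT, zeta_mul, ← hT, ← hT, T.apply_symm_apply, T.apply_symm_apply, groupoidMul_single]
  split_ifs <;> simp

end InverseSemigroup

/-! ### Invariant means from asymptotically invariant functionals -/

/-- The Banach space `ℓ^∞(G)` of bounded real functions. -/
abbrev BddFun (G : Type*) := lp (fun _ : G => ℝ) ∞

section Mean

variable {G : Type*}


theorem abs_apply_le_norm (f : BddFun G) (x : G) : |f x| ≤ ‖f‖ :=
  lp.norm_apply_le_norm (E := fun _ : G => ℝ) (by simp) f x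

theorem norm_le_of_abs_le {f : BddFun G} {C : ℝ} (hC : 0 ≤ C) (h : ∀ x, |f x| ≤ C) : ‖f‖ ≤ C :=
  lp.norm_le_of_forall_le hC h

theorem norm_le_norm_of_abs_le {f h : BddFun G} (hf : ∀ x, |h x| ≤ f x) : ‖h‖ ≤ ‖f‖ :=
  norm_le_of_abs_le (norm_nonneg _) fun x =>
    (hf x).trans ((le_abs_self _).trans (abs_apply_le_norm f x))

theorem bdd_one_apply (x : G) : (1 : BddFun G) x = 1 := by
  rw [lp.infty_coeFn_one]; rfl

/-- A functional on the cone of nonnegative bounded functions that is additive and positively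
homogeneous extends to a linear functional. -/
theorem exists_linear_extension (L : BddFun G → ℝ)
    (hadd : ∀ f g, (∀ x, 0 ≤ f x) → (∀ x, 0 ≤ g x) → L (f + g) = L f + L g)
    (hsmul : ∀ (c : ℝ) f, 0 ≤ c → (∀ x, 0 ≤ f x) → L (c • f) = c * L f) :
    ∃ μ : BddFun G →ₗ[ℝ] ℝ, ∀ f, (∀ x, 0 ≤ f x) → μ f = L f := by
  have h1 : ∀ x, 0 ≤ (1 : BddFun G) x := fun x => by rw [bdd_one_apply]; exact zero_le_one
  have hc1 : ∀ c : ℝ, 0 ≤ c → ∀ x, 0 ≤ (c • (1 : BddFun G)) x := fun c hc x => mul_nonneg hc (h1 x)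
  have hpos : ∀ (f : BddFun G) (c : ℝ), ‖f‖ ≤ c → ∀ x, 0 ≤ (f + c • (1 : BddFun G)) x :=
      fun f c hc x => by
    have h₁ := (neg_abs_le (f x)).trans' (neg_le_neg ((abs_apply_le_norm f x).trans hc))
    have h₂ : (f + c • (1 : BddFun G)) x = f x + c := by
      change f x + c * (1 : BddFun G) x = _
      rw [bdd_one_apply, mul_one]
    rw [h₂]; linarith
  -- The constant `‖f‖` shifts `f` into the nonnegative cone.
  set W : BddFun G → ℝ := fun f => L (f + ‖f‖ • (1 : BddFun G)) - ‖f‖ * L 1 with hW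
  -- Every larger constant gives the same value, so `f`, `g` and `f + g` can be compared after
  -- compatible shifts.
  have key : ∀ (f : BddFun G) (c : ℝ), ‖f‖ ≤ c → L (f + c • (1 : BddFun G)) - c * L 1 = W f := by
    intro f c hc
    have h : f + c • (1 : BddFun G) = (f + ‖f‖ • (1 : BddFun G)) + (c - ‖f‖) • (1 : BddFun G) := by
      rw [sub_smul]; abel
    rw [h, hadd _ _ (hpos f _ le_rfl) (hc1 _ (sub_nonneg.2 hc)), hsmul _ _ (sub_nonneg.2 hc) h1]
    simp only [hW]
    ring
  have Wadd : ∀ f g, W (f + g) = W f + W g := by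
    intro f g
    rw [← key (f + g) (‖f‖ + ‖g‖) (norm_add_le f g)]
    have h : f + g + (‖f‖ + ‖g‖) • (1 : BddFun G) =
        (f + ‖f‖ • (1 : BddFun G)) + (g + ‖g‖ • (1 : BddFun G)) := by
      rw [add_smul]; abel
    rw [h, hadd _ _ (hpos f _ le_rfl) (hpos g _ le_rfl)]
    simp only [hW]
    ring
  have Wsmul : ∀ (c : ℝ), 0 ≤ c → ∀ f, W (c • f) = c * W f := by
    intro c hc f
    have h : c • f + ‖c • f‖ • (1 : BddFun G) = c • (f + ‖f‖ • (1 : BddFun G)) := by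
      rw [norm_smul, Real.norm_of_nonneg hc, smul_add, mul_smul]
    simp only [hW]
    rw [h, hsmul _ _ hc (hpos f _ le_rfl), norm_smul, Real.norm_of_nonneg hc]
    ring
  have Wneg : ∀ f, W (-f) = - W f := by
    intro f
    have h0 : W 0 = 0 := by simpa using Wsmul 0 le_rfl 0
    have := Wadd f (-f)
    rw [add_neg_cancel, h0] at this
    linarith
  refine ⟨{ toFun := W, map_add' := Wadd, map_smul' := fun c f => ?_ }, fun f hf => ?_⟩
  · rcases le_total 0 c with hc | hc
    · exact Wsmul c hc f
    · have := Wsmul (-c) (neg_nonneg.2 hc) f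
      rw [neg_smul, Wneg] at this
      simp only [RingHom.id_apply, smul_eq_mul]
      linarith
  · change L (f + ‖f‖ • (1 : BddFun G)) - ‖f‖ * L 1 = L f
    rw [hadd _ _ hf (hc1 _ (norm_nonneg f)), hsmul _ _ (norm_nonneg f) h1]
    ring

/-- The total variation of a functional `M` on bounded functions, `f ↦ sup {M h : |h| ≤ f}`. -/
def variation (M : BddFun G →ₗ[ℝ] ℝ) (f : BddFun G) : ℝ :=
  sSup (Set.image M {h | ∀ x, |h x| ≤ f x})

variable {M : BddFun G →ₗ[ℝ] ℝ} {C : ℝ}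

theorem le_variation (hM : ∀ f, |M f| ≤ C * ‖f‖) (hC : 0 ≤ C)
    {f h : BddFun G} (hf : ∀ x, |h x| ≤ f x) : M h ≤ variation M f := by
  refine le_csSup ⟨C * ‖f‖, ?_⟩ ⟨h, hf, rfl⟩
  rintro _ ⟨k, hk, rfl⟩
  exact (le_abs_self _).trans ((hM k).trans
    (mul_le_mul_of_nonneg_left (norm_le_norm_of_abs_le hk) hC))

theorem variation_le {f : BddFun G} (hf : ∀ x, 0 ≤ f x) {B : ℝ}
    (h : ∀ k : BddFun G, (∀ x, |k x| ≤ f x) → M k ≤ B) : variation M f ≤ B := by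
  refine csSup_le ⟨M 0, 0, fun x => ?_, rfl⟩ ?_
  · change |(0 : ℝ)| ≤ f x
    simpa using hf x
  · rintro _ ⟨k, hk, rfl⟩
    exact h k hk

theorem variation_nonneg (hM : ∀ f, |M f| ≤ C * ‖f‖) (hC : 0 ≤ C)
    {f : BddFun G} (hf : ∀ x, 0 ≤ f x) : 0 ≤ variation M f := by
  have := le_variation hM hC (f := f) (h := 0) fun x => by
    change |(0 : ℝ)| ≤ f x
    simpa using hf x
  rwa [map_zero] at this

theorem variation_add (hM : ∀ f, |M f| ≤ C * ‖f‖) (hC : 0 ≤ C)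
    {f g : BddFun G} (hf : ∀ x, 0 ≤ f x) (hg : ∀ x, 0 ≤ g x) :
    variation M (f + g) = variation M f + variation M g := by
  apply le_antisymm
  · refine variation_le (fun x => add_nonneg (hf x) (hg x)) fun k hk => ?_
    -- Riesz decomposition: `k₁` truncates `k` to `[-f, f]`, and the remainder is then bounded by
    -- `g` because `|k| ≤ f + g`.
    let k₁ : BddFun G := ⟨fun x => max (-f x) (min (k x) (f x)), memℓp_infty ⟨‖f‖, by
      rintro _ ⟨x, rfl⟩
      refine le_trans ?_ ((le_abs_self _).trans (abs_apply_le_norm f x))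
      change |max (-f x) (min (k x) (f x))| ≤ f x
      rw [abs_le]
      exact ⟨le_max_left _ _, max_le (by linarith [hf x]) (min_le_right _ _)⟩⟩⟩
    have h₁ : ∀ x, k₁ x = max (-f x) (min (k x) (f x)) := fun x => rfl
    have h₂ : ∀ x, |k x| ≤ f x + g x := hk
    have e : M k = M k₁ + M (k - k₁) := by rw [← map_add]; congr 1; abel
    rw [e]
    refine add_le_add (le_variation hM hC fun x => ?_) (le_variation hM hC fun x => ?_)
    · rw [h₁, abs_le]
      exact ⟨le_max_left _ _, max_le (by linarith [hf x]) (min_le_right _ _)⟩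
    · change |k x - k₁ x| ≤ g x
      have := abs_le.1 (h₂ x)
      have hfx := hf x
      have hgx := hg x
      rw [h₁, abs_le]
      rcases le_total (k x) (f x) with h | h
      · rw [min_eq_left h]
        rcases le_total (-f x) (k x) with h' | h'
        · rw [max_eq_right h']; constructor <;> linarith
        · rw [max_eq_left h']; constructor <;> linarith
      · rw [min_eq_right h, max_eq_right (by linarith)]; constructor <;> linarith
  · rw [← le_sub_iff_add_le]
    refine variation_le hf fun k hk => ?_
    rw [le_sub_comm]
    refine variation_le hg fun l hl => ?_
    rw [le_sub_iff_add_le, add_comm, ← map_add]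
    exact le_variation hM hC fun x => (abs_add_le _ _).trans (add_le_add (hk x) (hl x))

theorem variation_smul (hM : ∀ f, |M f| ≤ C * ‖f‖) (hC : 0 ≤ C)
    {c : ℝ} {f : BddFun G} (hc : 0 ≤ c) (hf : ∀ x, 0 ≤ f x) :
    variation M (c • f) = c * variation M f := by
  rcases hc.eq_or_lt with rfl | hc
  · have h := variation_add hM hC (f := 0) (g := 0) (fun _ => le_rfl) fun _ => le_rfl
    rw [add_zero] at h
    rw [zero_smul]
    linarith
  have key : ∀ {c : ℝ} {f : BddFun G}, 0 < c → (∀ x, 0 ≤ f x) →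
      c * variation M f ≤ variation M (c • f) := fun {c f} hc hf => by
    rw [← le_div_iff₀' hc]
    refine variation_le hf fun k hk => ?_
    rw [le_div_iff₀' hc, ← smul_eq_mul, ← map_smul]
    refine le_variation hM hC fun x => ?_
    change |c * k x| ≤ c * f x
    rw [abs_mul, abs_of_pos hc]
    exact mul_le_mul_of_nonneg_left (hk x) hc.le
  -- The other inequality is `key` for the scalar `c⁻¹` and the function `c • f`.
  refine le_antisymm ?_ (key hc hf)
  have := key (inv_pos.2 hc) (f := c • f) fun x => mul_nonneg hc.le (hf x)
  rwa [inv_smul_smul₀ hc.ne', inv_mul_le_iff₀ hc] at this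

theorem variation_le_norm_mul (hM : ∀ f, |M f| ≤ C * ‖f‖) (hC : 0 ≤ C)
    {f : BddFun G} (hf : ∀ x, 0 ≤ f x) :
    variation M f ≤ ‖f‖ * variation M 1 := by
  rw [← variation_smul hM hC (norm_nonneg f) fun x => by rw [bdd_one_apply]; exact zero_le_one]
  refine variation_le hf fun k hk => le_variation hM hC fun x => ?_
  change |k x| ≤ ‖f‖ * (1 : BddFun G) x
  rw [bdd_one_apply, mul_one]
  exact (hk x).trans ((le_abs_self _).trans (abs_apply_le_norm f x))

variable [Group G]

theorem leftTranslate_apply (g : G) (f : BddFun G) (x : G) : leftTranslate g f x = f (g * x) := rfl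

theorem leftTranslate_inv (g : G) (f : BddFun G) : leftTranslate g (leftTranslate g⁻¹ f) = f := by
  refine lp.ext (funext fun x => ?_)
  rw [leftTranslate_apply, leftTranslate_apply, inv_mul_cancel_left]

/-- Translation matches the functions dominated by `f` with those dominated by its translate, and
moves `M` by at most `ε ‖f‖` on each; the suprema differ by no more. -/
theorem abs_variation_leftTranslate_sub_le (hM : ∀ f, |M f| ≤ C * ‖f‖) (hC : 0 ≤ C)
    {g : G} {ε : ℝ} (hε : 0 ≤ ε)
    (h : ∀ f, |M (leftTranslate g f) - M f| ≤ ε * ‖f‖) {f : BddFun G} (hf : ∀ x, 0 ≤ f x) :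
    |variation M (leftTranslate g f) - variation M f| ≤ ε * ‖f‖ := by
  rw [abs_le, neg_le_sub_iff_le_add, sub_le_iff_le_add]
  have hle : ∀ {k : BddFun G}, (∀ x, |k x| ≤ f x) → ε * ‖k‖ ≤ ε * ‖f‖ := fun hk =>
    mul_le_mul_of_nonneg_left (norm_le_norm_of_abs_le hk) hε
  constructor
  · refine variation_le hf fun k hk => ?_
    have h₁ := (abs_le.1 (h k)).1
    have h₂ : M (leftTranslate g k) ≤ variation M (leftTranslate g f) :=
      le_variation hM hC fun x => hk (g * x)
    linarith [hle hk]
  · refine variation_le (f := leftTranslate g f) (fun x => hf (g * x)) fun k hk => ?_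
    have hk' : ∀ x, |leftTranslate g⁻¹ k x| ≤ f x := fun x => by
      have := hk (g⁻¹ * x)
      rwa [leftTranslate_apply, mul_inv_cancel_left] at this
    have h₁ := (abs_le.1 (h (leftTranslate g⁻¹ k))).2
    rw [leftTranslate_inv] at h₁
    have h₂ := le_variation hM hC hk'
    linarith [hle hk']

/-- A group with a net of bounded functionals on `ℓ^∞(G)` which is asymptotically left invariant
in norm and asymptotically normalized is amenable. -/
theorem amenableGroup_of_net {ι : Type*} {l : Filter ι} [l.NeBot] (M : ι → BddFun G →ₗ[ℝ] ℝ)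
    (C : ι → ℝ) (hM : ∀ i f, |M i f| ≤ C i * ‖f‖) (hC : ∀ i, 0 ≤ C i)
    (ε : G → ι → ℝ) (hε : ∀ g i, 0 ≤ ε g i)
    (h : ∀ g i f, |M i (leftTranslate g f) - M i f| ≤ ε g i * ‖f‖)
    (hlim : ∀ g, Tendsto (ε g) l (𝓝 0)) (hone : Tendsto (fun i => M i 1) l (𝓝 1)) :
    AmenableGroup G := by
  have h1 : ∀ x, 0 ≤ (1 : BddFun G) x := fun x => by rw [bdd_one_apply]; exact zero_le_one
  let U : Ultrafilter ι := Ultrafilter.of l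
  have hU : (U : Filter ι) ≤ l := Ultrafilter.of_le l
  -- Since `M i 1 → 1`, the normalizing denominators stay away from `0`. With this, no uniform bound
  -- on `C i` is needed: the ratios `R i f` lie in `[0, ‖f‖]`.
  have hhalf : ∀ᶠ i in U, 1 / 2 ≤ variation (M i) 1 := by
    filter_upwards [hU (hone.eventually (lt_mem_nhds (show (1 / 2 : ℝ) < 1 by norm_num)))]
      with i hi
    exact hi.le.trans (le_variation (hM i) (hC i) fun x => by rw [bdd_one_apply, abs_one])
  let R : ι → BddFun G → ℝ := fun i f => variation (M i) f / variation (M i) 1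
  have hex : ∀ f : BddFun G, ∃ r, (∀ x, 0 ≤ f x) → Tendsto (fun i => R i f) U (𝓝 r) := by
    intro f
    by_cases hf : ∀ x, 0 ≤ f x
    · have hmem : ∀ᶠ i in U, R i f ∈ Set.Icc 0 ‖f‖ := by
        filter_upwards [hhalf] with i hi
        have hpos : 0 < variation (M i) 1 := by linarith
        exact ⟨div_nonneg (variation_nonneg (hM i) (hC i) hf) hpos.le,
          (div_le_iff₀ hpos).2 (variation_le_norm_mul (hM i) (hC i) hf)⟩
      obtain ⟨r, -, hr⟩ := isCompact_Icc.ultrafilter_le_nhds (U.map fun i => R i f)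
        (le_principal_iff.2 hmem)
      exact ⟨r, fun _ => hr⟩
    · exact ⟨0, fun hf' => absurd hf' hf⟩
  choose L hL using hex
  obtain ⟨μ, hμ⟩ := exists_linear_extension L
    (fun f g hf hg => by
      refine tendsto_nhds_unique (hL (f + g) fun x => add_nonneg (hf x) (hg x)) ?_
      refine ((hL f hf).add (hL g hg)).congr fun i => ?_
      simp only [R]
      rw [variation_add (hM i) (hC i) hf hg, add_div])
    (fun c f hc hf => by
      refine tendsto_nhds_unique (hL (c • f) fun x => mul_nonneg hc (hf x)) ?_
      refine ((hL f hf).const_mul c).congr fun i => ?_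
      simp only [R]
      rw [variation_smul (hM i) (hC i) hc hf, mul_div_assoc])
  have hL1 : L 1 = 1 := by
    refine tendsto_nhds_unique (hL 1 h1) ?_
    refine tendsto_const_nhds.congr' ?_
    filter_upwards [hhalf] with i hi
    exact (div_self (by linarith)).symm
  have hinv : ∀ g f, (∀ x, 0 ≤ f x) → L (leftTranslate g f) = L f := by
    intro g f hf
    have hz : Tendsto (fun i => R i (leftTranslate g f) - R i f) U (𝓝 0) := by
      -- The factor `2` comes from dividing by a variation that is at least `1 / 2`.
      have h0 : Tendsto (fun i => 2 * (ε g i * ‖f‖)) U (𝓝 0) := by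
        simpa using (((hlim g).mono_left hU).mul_const ‖f‖).const_mul 2
      refine squeeze_zero_norm' ?_ h0
      filter_upwards [hhalf] with i hi
      have hpos : 0 < variation (M i) 1 := by linarith
      have hv := abs_variation_leftTranslate_sub_le (hM i) (hC i) (hε g i) (h g i) hf
      simp only [R]
      rw [Real.norm_eq_abs, ← sub_div, abs_div, abs_of_pos hpos, div_le_iff₀ hpos]
      have : 0 ≤ ε g i * ‖f‖ := mul_nonneg (hε g i) (norm_nonneg _)
      nlinarith
    have := tendsto_nhds_unique hz ((hL (leftTranslate g f) fun x => hf _).sub (hL f hf))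
    linarith
  refine ⟨μ, fun f hf => ?_, by rw [hμ 1 h1, hL1], fun g f => ?_⟩
  · rw [hμ f hf]
    refine ge_of_tendsto (hL f hf) ?_
    filter_upwards [hhalf] with i hi
    exact div_nonneg (variation_nonneg (hM i) (hC i) hf) (by linarith)
  -- Invariance is known on nonnegative functions; adding a constant, which translation fixes,
  -- extends it to all `f`.
  · have hp : ∀ x, 0 ≤ (f + ‖f‖ • (1 : BddFun G)) x := fun x => by
      change 0 ≤ f x + ‖f‖ * (1 : BddFun G) x
      rw [bdd_one_apply, mul_one]
      linarith [neg_abs_le (f x), abs_apply_le_norm f x]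
    have e₁ : leftTranslate g (f + ‖f‖ • (1 : BddFun G)) =
        leftTranslate g f + ‖f‖ • (1 : BddFun G) :=
      lp.ext (funext fun x => by
        change f (g * x) + ‖f‖ * (1 : BddFun G) (g * x) = f (g * x) + ‖f‖ * (1 : BddFun G) x
        rw [bdd_one_apply, bdd_one_apply])
    have e₂ : μ (leftTranslate g (f + ‖f‖ • (1 : BddFun G))) = μ (f + ‖f‖ • (1 : BddFun G)) := by
      rw [hμ _ hp, hμ (leftTranslate g (f + ‖f‖ • (1 : BddFun G))) fun x => hp (g * x),
        hinv g _ hp]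
    rw [e₁, map_add, map_add] at e₂
    linarith

end Mean

/-! ### Necessity: finite classes and amenable subgroups -/

namespace InverseSemigroup

open L1Alg BanachAlg

theorem ite_eq_ite_of_iff {α : Type*} {P Q : Prop} {_ : Decidable P} {_ : Decidable Q}
    {a b c d : α} (h : P ↔ Q) (hab : a = b) (hcd : c = d) :
    (if P then a else c) = if Q then b else d :=
  if_congr h hab hcd

variable {S : Type*} [InverseSemigroup S] (T : L1Alg S ≃L[ℂ] L1Alg S)

/-- The element of `ℓ¹(S)` that a groupoid transform sends to the point mass at `s`. -/
def gbasis (s : S) : L1Alg S := T.symm (single s 1)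

open scoped Classical in
theorem IsGroupoidTransform.gbasis_mul {T : L1Alg S ≃L[ℂ] L1Alg S} (hT : IsGroupoidTransform T)
    (s t : S) : gbasis T s * gbasis T t = if rid s = lid t then gbasis T (s * t) else 0 :=
  hT s t

theorem norm_gbasis_le (s : S) : ‖gbasis T s‖ ≤ ‖(T.symm : L1Alg S →L[ℂ] L1Alg S)‖ := by
  have := (T.symm : L1Alg S →L[ℂ] L1Alg S).le_opNorm (single s 1)
  rwa [norm_single, norm_one, mul_one] at this

section

variable {F : Type*} [NormedAddCommGroup F] [NormedSpace ℂ F]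

theorem ext_gbasis {U V : L1Alg S →L[ℂ] F} (h : ∀ s, U (gbasis T s) = V (gbasis T s)) :
    U = V := by
  have h' : U.comp (T.symm : L1Alg S →L[ℂ] L1Alg S) = V.comp (T.symm : L1Alg S →L[ℂ] L1Alg S) :=
    ext_single h
  ext a
  simpa using DFunLike.congr_fun h' (T a)

theorem ext_tmul_gbasis {U V : ProjSq (L1Alg S) →L[ℂ] F}
    (h : ∀ s t, U (tmul (gbasis T s) (gbasis T t)) = V (tmul (gbasis T s) (gbasis T t))) :
    U = V := by
  have h' : (ContinuousLinearMap.compL ℂ _ _ _ U).comp (tmulL (L1Alg S)) =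
      (ContinuousLinearMap.compL ℂ _ _ _ V).comp (tmulL (L1Alg S)) :=
    ext_gbasis T fun s => ext_gbasis T fun t => h s t
  exact ext_tmul fun a b => DFunLike.congr_fun (DFunLike.congr_fun h' a) b

variable [CompleteSpace F]

/-- The bounded operator with prescribed values on the elements `gbasis T s`. -/
def liftGB (v : S → F) (C : ℝ) (hv : ∀ s, ‖v s‖ ≤ C) : L1Alg S →L[ℂ] F :=
  (lift v C hv).comp (T : L1Alg S →L[ℂ] L1Alg S)

theorem liftGB_gbasis (v : S → F) (C : ℝ) (hv : ∀ s, ‖v s‖ ≤ C) (s : S) :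
    liftGB T v C hv (gbasis T s) = v s := by
  refine Eq.trans (congrArg (lift v C hv) (T.apply_symm_apply (single s 1))) ?_
  exact lift_single v C hv s

theorem norm_liftGB_le (v : S → F) (C : ℝ) (hv : ∀ s, ‖v s‖ ≤ C) (hC : 0 ≤ C) :
    ‖liftGB T v C hv‖ ≤ C * ‖(T : L1Alg S →L[ℂ] L1Alg S)‖ :=
  (ContinuousLinearMap.opNorm_comp_le _ _).trans
    (mul_le_mul_of_nonneg_right (norm_lift_le v C hv hC) (norm_nonneg _))

end

open scoped Classical in
/-- The functional on `ℓ¹(S)` which is the indicator function of a set of arrows in the groupoid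
coordinates. -/
def indicatorGB (P : S → Prop) : StrongDual ℂ (L1Alg S) :=
  liftGB T (fun s => if P s then (1 : ℂ) else 0) 1 fun s => by split_ifs <;> simp

open scoped Classical in
theorem indicatorGB_gbasis (P : S → Prop) (s : S) :
    indicatorGB T P (gbasis T s) = if P s then (1 : ℂ) else 0 :=
  liftGB_gbasis T _ _ _ s

theorem norm_indicatorGB_le (P : S → Prop) :
    ‖indicatorGB T P‖ ≤ ‖(T : L1Alg S →L[ℂ] L1Alg S)‖ := by
  classical
  exact (norm_liftGB_le T _ 1 _ zero_le_one).trans_eq (one_mul _)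

/-- The functional which sums the coordinates over the arrows between `p` and `e`. -/
def arrowSum (p e : S) : StrongDual ℂ (L1Alg S) :=
  indicatorGB T fun s => lid s = p ∧ rid s = e

variable {T}

/-- A composable product `x s` has the same ends as `x` exactly when `s` is a loop at `rid x`. -/
theorem adj_mulLeft_arrowSum (hT : IsGroupoidTransform T) (x : S) :
    adj (mulLeft (gbasis T x)) (arrowSum T (lid x) (rid x)) = arrowSum T (rid x) (rid x) := by
  refine ext_gbasis T fun s => ?_
  change arrowSum T (lid x) (rid x) (gbasis T x * gbasis T s) = _
  rw [hT.gbasis_mul]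
  by_cases h : rid x = lid s
  · rw [if_pos h]
    simp only [arrowSum, indicatorGB_gbasis]
    exact ite_eq_ite_of_iff (by rw [lid_mul_of_eq h, rid_mul_of_eq h, h]; simp) rfl rfl
  · simp only [if_neg h, map_zero, arrowSum, indicatorGB_gbasis, Ne.symm h, false_and, if_false]

theorem adj_mulRight_arrowSum (hT : IsGroupoidTransform T) (x : S) :
    adj (mulRight (gbasis T x)) (arrowSum T (lid x) (rid x)) = arrowSum T (lid x) (lid x) := by
  refine ext_gbasis T fun s => ?_
  change arrowSum T (lid x) (rid x) (gbasis T s * gbasis T x) = _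
  rw [hT.gbasis_mul]
  by_cases h : rid s = lid x
  · rw [if_pos h]
    simp only [arrowSum, indicatorGB_gbasis]
    exact ite_eq_ite_of_iff (by rw [lid_mul_of_eq h, rid_mul_of_eq h, h]; simp) rfl rfl
  · rw [if_neg h]
    simp only [map_zero, arrowSum, indicatorGB_gbasis, h, and_false, if_false]

/-- A functional on `ℓ¹(S)*` that commutes with `ℓ¹(S)` has the same value on the traces of
isomorphic corners. -/
theorem central_arrowSum_eq (hT : IsGroupoidTransform T) {n : StrongDual ℂ (StrongDual ℂ (L1Alg S))}
    (hn : ∀ a, biadj (mulLeft a) n = biadj (mulRight a) n) (x : S) :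
    n (arrowSum T (rid x) (rid x)) = n (arrowSum T (lid x) (lid x)) := by
  have := DFunLike.congr_fun (hn (gbasis T x)) (arrowSum T (lid x) (rid x))
  rwa [biadj_apply, biadj_apply, adj_mulLeft_arrowSum hT, adj_mulRight_arrowSum hT] at this

/-- The traces at distinct idempotents have disjoint supports in groupoid coordinates, so their sum
is again an indicator, with a norm bound independent of `E`. -/
theorem sum_arrowSum (E : Finset S) :
    ∑ e ∈ E, arrowSum T e e = indicatorGB T fun s => lid s = rid s ∧ lid s ∈ E := by
  classical
  refine ext_gbasis T fun s => ?_
  rw [sum_apply, indicatorGB_gbasis]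
  simp only [arrowSum, indicatorGB_gbasis]
  by_cases h : lid s = rid s
  · simp [← h]
  · rw [if_neg (by tauto)]
    refine Finset.sum_eq_zero fun e _ => if_neg ?_
    rintro ⟨h₁, h₂⟩
    exact h (h₁.trans h₂.symm)

/-- For every `k`, the class contains `k` idempotents with the same trace value `c`, and the sum of
these traces has norm at most `‖T‖`. So `k ‖c‖` is bounded in `k`, which forces `c = 0`. -/
theorem central_arrowSum_eq_zero (hT : IsGroupoidTransform T)
    {n : StrongDual ℂ (StrongDual ℂ (L1Alg S))}
    (hn : ∀ a, biadj (mulLeft a) n = biadj (mulRight a) n) {s : S}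
    (hs : {e : S | IsIdempotentElem e ∧ DRel s e}.Infinite) :
    n (arrowSum T (lid s) (lid s)) = 0 := by
  set c := n (arrowSum T (lid s) (lid s)) with hc
  have hval : ∀ e ∈ {e : S | IsIdempotentElem e ∧ DRel s e}, n (arrowSum T e e) = c := by
    rintro e ⟨he, x, hx₁, hx₂⟩
    have h₁ : lid s = lid x := hx₁
    have h₂ : e = rid x := by rw [← rid_idem he]; exact hx₂
    rw [hc, h₁, h₂]
    exact central_arrowSum_eq hT hn x
  have hbound : ∀ k : ℕ, k * ‖c‖ ≤ ‖n‖ * ‖(T : L1Alg S →L[ℂ] L1Alg S)‖ := by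
    intro k
    obtain ⟨E, hE, hk⟩ := hs.exists_subset_card_eq k
    have h : n (∑ e ∈ E, arrowSum T e e) = k * c := by
      rw [map_sum, Finset.sum_congr rfl fun e he => hval e (hE he), Finset.sum_const, hk,
        nsmul_eq_mul]
    calc k * ‖c‖ = ‖n (∑ e ∈ E, arrowSum T e e)‖ := by rw [h, norm_mul, Complex.norm_natCast]
      _ ≤ ‖n‖ * ‖∑ e ∈ E, arrowSum T e e‖ := n.le_opNorm _
      _ ≤ _ := by
        rw [sum_arrowSum]
        exact mul_le_mul_of_nonneg_left (norm_indicatorGB_le T _) n.opNorm_nonneg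
  by_contra h0
  have hpos : 0 < ‖c‖ := norm_pos_iff.2 h0
  obtain ⟨k, hk⟩ := exists_nat_gt (‖n‖ * ‖(T : L1Alg S →L[ℂ] L1Alg S)‖ / ‖c‖)
  rw [div_lt_iff₀ hpos] at hk
  exact absurd (hbound k) (not_le.2 hk)

/-- The trace at `p` is unchanged by left multiplication by the identity at `p`, and it equals `1`
on that identity. -/
theorem tendsto_arrowSum (hT : IsGroupoidTransform T) {ι : Type*} {l : Filter ι}
    {n : ι → StrongDual ℂ (StrongDual ℂ (L1Alg S))} {p : S} (hp : IsIdempotentElem p)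
    (h : Tendsto (fun i => biadj (mulLeft (gbasis T p)) (n i)) l
      (𝓝 (NormedSpace.inclusionInDoubleDual ℂ (L1Alg S) (gbasis T p)))) :
    Tendsto (fun i => n i (arrowSum T p p)) l (𝓝 1) := by
  have h₁ := ((ContinuousLinearMap.apply ℂ ℂ (arrowSum T p p)).continuous.tendsto _).comp h
  have h₂ : (ContinuousLinearMap.apply ℂ ℂ (arrowSum T p p))
      (NormedSpace.inclusionInDoubleDual ℂ (L1Alg S) (gbasis T p)) = 1 := by
    change arrowSum T p p (gbasis T p) = 1
    rw [arrowSum, indicatorGB_gbasis, if_pos ⟨lid_idem hp, rid_idem hp⟩]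
  rw [h₂] at h₁
  refine h₁.congr fun i => ?_
  have := adj_mulLeft_arrowSum hT p
  rw [lid_idem hp, rid_idem hp] at this
  change n i (adj (mulLeft (gbasis T p)) (arrowSum T p p)) = _
  rw [this]

theorem finite_of_strongPseudoAmenable (hT : IsGroupoidTransform T)
    (h : StrongPseudoAmenable (L1Alg S)) (s : S) :
    {e : S | IsIdempotentElem e ∧ DRel s e}.Finite := by
  obtain ⟨ι, _, _, _, m, hm⟩ := h
  by_contra hinf
  have h₁ := tendsto_arrowSum hT (idem_lid s) (hm (gbasis T (lid s))).2.2
  have h₂ : ∀ i, biadj (prodMor (L1Alg S)) (m i) (arrowSum T (lid s) (lid s)) = 0 := fun i =>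
    central_arrowSum_eq_zero hT (fun a => (hm a).2.1 i) hinf
  simp only [h₂] at h₁
  exact zero_ne_one (tendsto_nhds_unique tendsto_const_nhds h₁)

theorem lid_val {p : {p : S // IsIdempotentElem p}} (g : MaxSubgroup p) : lid g.val = p.1 :=
  g.mul_inv

theorem rid_val {p : {p : S // IsIdempotentElem p}} (g : MaxSubgroup p) : rid g.val = p.1 :=
  g.inv_mul

/-- Fix one reference arrow `x` from `p` to each reachable right end and set `κ s = s x⁻¹`. Left
multiplication by `g ∈ G_p` keeps the right end, hence the reference arrow, so `κ` is equivariant;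
elsewhere its value is arbitrary. -/
theorem exists_equivariant (p : {p : S // IsIdempotentElem p}) :
    ∃ κ : S → MaxSubgroup p, ∀ (g : MaxSubgroup p) (s : S), lid s = p.1 →
      κ (g.val * s) = g * κ s := by
  classical
  have hex : ∀ e : S, ∃ x, ∀ y, lid y = p.1 → rid y = e → lid x = p.1 ∧ rid x = e := by
    intro e
    by_cases h : ∃ y, lid y = p.1 ∧ rid y = e
    · exact ⟨h.choose, fun _ _ _ => h.choose_spec⟩
    · exact ⟨p.1, fun y h₁ h₂ => absurd ⟨y, h₁, h₂⟩ h⟩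
  choose x hx using hex
  have hcomp : ∀ s, lid s = p.1 → rid s = lid (x (rid s))⁻¹ := fun s hs => by
    rw [lid_inv, (hx _ s hs rfl).2]
  let κ : S → MaxSubgroup p := fun s => if h : lid s = p.1 then
    ⟨s * (x (rid s))⁻¹, (lid_mul_of_eq (hcomp s h)).trans h,
      (rid_mul_of_eq (hcomp s h)).trans ((rid_inv _).trans (hx _ s h rfl).1)⟩ else 1
  have hκ : ∀ s, lid s = p.1 → (κ s).val = s * (x (rid s))⁻¹ := fun s h => by
    simp only [κ, dif_pos h]
  refine ⟨κ, fun g s hs => MaxSubgroup.ext ?_⟩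
  have hgs : rid g.val = lid s := (rid_val g).trans hs.symm
  change _ = g.val * (κ s).val
  rw [hκ s hs, hκ _ ((lid_mul_of_eq hgs).trans (lid_val g)), rid_mul_of_eq hgs, mul_assoc]

variable {p : {p : S // IsIdempotentElem p}}

open scoped Classical in
/-- The values on arrows of the functional `meanForm`. -/
def meanCoeff (κ : S → MaxSubgroup p) (ψ : BddFun (MaxSubgroup p)) (s t : S) : ℂ :=
  if lid s = p.1 ∧ rid s = lid t ∧ rid t = p.1 then ((ψ (κ s) : ℝ) : ℂ) else 0

theorem norm_meanCoeff_le (κ : S → MaxSubgroup p) (ψ : BddFun (MaxSubgroup p)) (s t : S) :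
    ‖meanCoeff κ ψ s t‖ ≤ ‖ψ‖ := by
  rw [meanCoeff]
  split_ifs
  · rw [Complex.norm_real]
    exact abs_apply_le_norm ψ _
  · simp

variable (T) in
/-- The functional on `ℓ¹(S) ⊗ₚ ℓ¹(S)` induced by a bounded function on `G_p` through the left
factors of the composable pairs of arrows with product in `G_p`. -/
def meanForm (κ : S → MaxSubgroup p) (ψ : BddFun (MaxSubgroup p)) :
    StrongDual ℂ (ProjSq (L1Alg S)) :=
  liftSq (liftGB T (fun s => liftGB T (meanCoeff κ ψ s) ‖ψ‖ (norm_meanCoeff_le κ ψ s))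
    (‖ψ‖ * ‖(T : L1Alg S →L[ℂ] L1Alg S)‖) fun _ => norm_liftGB_le T _ _ _ (norm_nonneg _))

theorem meanForm_tmul (κ : S → MaxSubgroup p) (ψ : BddFun (MaxSubgroup p)) (s t : S) :
    meanForm T κ ψ (tmul (gbasis T s) (gbasis T t)) = meanCoeff κ ψ s t := by
  rw [meanForm, liftSq_tmul, liftGB_gbasis, liftGB_gbasis]

theorem norm_meanForm_le (κ : S → MaxSubgroup p) (ψ : BddFun (MaxSubgroup p)) :
    ‖meanForm T κ ψ‖ ≤ ‖(T : L1Alg S →L[ℂ] L1Alg S)‖ ^ 2 * ‖ψ‖ := by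
  refine (norm_liftSq_le _).trans ((norm_liftGB_le T _ _ _ (by positivity)).trans_eq ?_)
  ring

theorem meanForm_add (κ : S → MaxSubgroup p) (ψ φ : BddFun (MaxSubgroup p)) :
    meanForm T κ (ψ + φ) = meanForm T κ ψ + meanForm T κ φ := by
  refine ext_tmul_gbasis T fun s t => ?_
  rw [add_apply, meanForm_tmul, meanForm_tmul, meanForm_tmul]
  simp only [meanCoeff]
  split_ifs
  · exact Complex.ofReal_add _ _
  · rw [add_zero]

theorem meanForm_smul (κ : S → MaxSubgroup p) (c : ℝ) (ψ : BddFun (MaxSubgroup p)) :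
    meanForm T κ (c • ψ) = (c : ℂ) • meanForm T κ ψ := by
  refine ext_tmul_gbasis T fun s t => ?_
  rw [smul_apply, meanForm_tmul, meanForm_tmul]
  simp only [meanCoeff]
  split_ifs
  · exact Complex.ofReal_mul _ _
  · rw [smul_zero]

/-- The form sees the left factor through `κ`, so equivariance turns the action of `g` into
translation by `g`. -/
theorem adj_lactSq_meanForm (hT : IsGroupoidTransform T) {κ : S → MaxSubgroup p}
    (hκ : ∀ (g : MaxSubgroup p) (s : S), lid s = p.1 → κ (g.val * s) = g * κ s)
    (g : MaxSubgroup p) (ψ : BddFun (MaxSubgroup p)) :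
    adj (lactSq (gbasis T g.val)) (meanForm T κ ψ) = meanForm T κ (leftTranslate g ψ) := by
  refine ext_tmul_gbasis T fun s t => ?_
  rw [adj_apply, lactSq_tmul, hT.gbasis_mul, meanForm_tmul]
  by_cases h : lid s = p.1
  · have h' : rid g.val = lid s := (rid_val g).trans h.symm
    rw [if_pos h', meanForm_tmul]
    simp only [meanCoeff, hκ g s h]
    exact ite_eq_ite_of_iff (by rw [lid_mul_of_eq h', rid_mul_of_eq h', lid_val, h]) rfl rfl
  · rw [if_neg (by rw [rid_val]; exact Ne.symm h), ← tmulL_apply, map_zero, zero_apply, map_zero,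
      meanCoeff, if_neg (by tauto)]

/-- The right factor enters the form only through its ends, and multiplying on the right by a loop
at `p` keeps both. -/
theorem adj_ractSq_meanForm (hT : IsGroupoidTransform T) (κ : S → MaxSubgroup p) (g : MaxSubgroup p)
    (ψ : BddFun (MaxSubgroup p)) :
    adj (ractSq (gbasis T g.val)) (meanForm T κ ψ) = meanForm T κ ψ := by
  refine ext_tmul_gbasis T fun s t => ?_
  rw [adj_apply, ractSq_tmul, hT.gbasis_mul, meanForm_tmul]
  by_cases h : rid t = p.1
  · have h' : rid t = lid g.val := h.trans (lid_val g).symm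
    rw [if_pos h', meanForm_tmul]
    simp only [meanCoeff]
    exact ite_eq_ite_of_iff (by rw [lid_mul_of_eq h', rid_mul_of_eq h', rid_val, h]) rfl rfl
  · rw [if_neg (by rw [lid_val]; exact h), ← tmulL_apply, map_zero, map_zero,
      meanCoeff, if_neg (by tauto)]

/-- For the constant function `1`, the form is the trace at `p` of the product; this is what
normalizes the limiting mean. -/
theorem adj_prodMor_arrowSum (hT : IsGroupoidTransform T) (κ : S → MaxSubgroup p) :
    adj (prodMor (L1Alg S)) (arrowSum T p.1 p.1) = meanForm T κ 1 := by
  refine ext_tmul_gbasis T fun s t => ?_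
  rw [adj_apply, prodMor_tmul, hT.gbasis_mul, meanForm_tmul, meanCoeff]
  by_cases h : rid s = lid t
  · rw [if_pos h, arrowSum, indicatorGB_gbasis]
    refine ite_eq_ite_of_iff ?_ ?_ rfl
    · rw [lid_mul_of_eq h, rid_mul_of_eq h]
      tauto
    · rw [bdd_one_apply, Complex.ofReal_one]
  · rw [if_neg h, map_zero, if_neg (by tauto)]

variable (T) in
/-- The functional on `ℓ^∞(G_p)` induced by an element of `(ℓ¹(S) ⊗ₚ ℓ¹(S))**`. -/
def meanOf (κ : S → MaxSubgroup p) (m : StrongDual ℂ (StrongDual ℂ (ProjSq (L1Alg S)))) :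
    BddFun (MaxSubgroup p) →ₗ[ℝ] ℝ where
  toFun ψ := (m (meanForm T κ ψ)).re
  map_add' ψ φ := by rw [meanForm_add, map_add, Complex.add_re]
  map_smul' c ψ := by
    rw [meanForm_smul, map_smul, smul_eq_mul, Complex.re_ofReal_mul]
    rfl

theorem meanOf_apply (κ : S → MaxSubgroup p) (m : StrongDual ℂ (StrongDual ℂ (ProjSq (L1Alg S))))
    (ψ : BddFun (MaxSubgroup p)) : meanOf T κ m ψ = (m (meanForm T κ ψ)).re := rfl

theorem abs_meanOf_le (κ : S → MaxSubgroup p) (m : StrongDual ℂ (StrongDual ℂ (ProjSq (L1Alg S))))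
    (ψ : BddFun (MaxSubgroup p)) :
    |meanOf T κ m ψ| ≤ bidualNorm m * ‖(T : L1Alg S →L[ℂ] L1Alg S)‖ ^ 2 * ‖ψ‖ := by
  refine (Complex.abs_re_le_norm _).trans ((norm_apply_le_bidualNorm m _).trans ?_)
  rw [mul_assoc]
  exact mul_le_mul_of_nonneg_left (norm_meanForm_le κ ψ) (bidualNorm_nonneg m)

theorem amenableGroup_of_strongPseudoAmenable (hT : IsGroupoidTransform T)
    (h : StrongPseudoAmenable (L1Alg S))
    (p : {p : S // IsIdempotentElem p}) : AmenableGroup (MaxSubgroup p) := by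
  obtain ⟨ι, _, _, _, m, hm⟩ := h
  obtain ⟨κ, hκ⟩ := exists_equivariant p
  -- The commutator defect of `m i` at `g`. Testing it against `meanForm` gives the failure of
  -- invariance under `g`, so its norm controls that failure uniformly in `ψ`.
  let D : MaxSubgroup p → ι → StrongDual ℂ (StrongDual ℂ (ProjSq (L1Alg S))) := fun g i =>
    biadj (lactSq (gbasis T g.val)) (m i) - biadj (ractSq (gbasis T g.val)) (m i)
  have hD : ∀ g i ψ, meanOf T κ (m i) (leftTranslate g ψ) - meanOf T κ (m i) ψ =
      meanOf T κ (D g i) ψ := fun g i ψ => by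
    simp only [D, meanOf_apply]
    rw [sub_apply, biadj_apply, biadj_apply, adj_lactSq_meanForm hT hκ, adj_ractSq_meanForm hT,
      Complex.sub_re]
  refine amenableGroup_of_net (l := atTop) (fun i => meanOf T κ (m i))
    (fun i => bidualNorm (m i) * ‖(T : L1Alg S →L[ℂ] L1Alg S)‖ ^ 2) (fun i => abs_meanOf_le κ (m i))
    (fun i => mul_nonneg (bidualNorm_nonneg _) (by positivity))
    (fun g i => bidualNorm (D g i) * ‖(T : L1Alg S →L[ℂ] L1Alg S)‖ ^ 2)
    (fun g i => mul_nonneg (bidualNorm_nonneg _) (by positivity)) (fun g i ψ => ?_) (fun g => ?_) ?_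
  · rw [hD]
    exact abs_meanOf_le κ (D g i) ψ
  · have := (tendsto_bidualNorm_zero (hm (gbasis T g.val)).1).mul_const
      (‖(T : L1Alg S →L[ℂ] L1Alg S)‖ ^ 2)
    rwa [zero_mul] at this
  · have h₁ := tendsto_arrowSum hT p.2 (hm (gbasis T p.1)).2.2
    simp only [biadj_apply, adj_prodMor_arrowSum hT κ] at h₁
    exact (Complex.continuous_re.tendsto _).comp h₁

end InverseSemigroup

/-! ### Complex means and averages in a bidual -/

section ComplexMean

variable {G : Type*}

open scoped Classical in
/-- A bounded function as an element of `ℓ^∞(G)`, and `0` for an unbounded one. -/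
def toBdd (f : G → ℝ) : BddFun G :=
  if h : ∃ C, ∀ x, |f x| ≤ C then
    ⟨f, memℓp_infty ⟨h.choose, by rintro _ ⟨x, rfl⟩; exact h.choose_spec x⟩⟩ else 0

theorem toBdd_apply {f : G → ℝ} {C : ℝ} (h : ∀ x, |f x| ≤ C) (x : G) : toBdd f x = f x := by
  rw [toBdd, dif_pos ⟨C, h⟩]

/-- The extension of a mean to complex functions. -/
def cmean (μ : BddFun G →ₗ[ℝ] ℝ) (F : G → ℂ) : ℂ :=
  μ (toBdd fun x => (F x).re) + μ (toBdd fun x => (F x).im) * Complex.I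

theorem abs_re_le_of_norm_le {F : G → ℂ} {C : ℝ} (h : ∀ x, ‖F x‖ ≤ C) (x : G) :
    |(F x).re| ≤ C := (Complex.abs_re_le_norm _).trans (h x)

theorem abs_im_le_of_norm_le {F : G → ℂ} {C : ℝ} (h : ∀ x, ‖F x‖ ≤ C) (x : G) :
    |(F x).im| ≤ C := (Complex.abs_im_le_norm _).trans (h x)

variable (μ : BddFun G →ₗ[ℝ] ℝ)

theorem cmean_add {F H : G → ℂ} {C D : ℝ} (hF : ∀ x, ‖F x‖ ≤ C) (hH : ∀ x, ‖H x‖ ≤ D) :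
    cmean μ (fun x => F x + H x) = cmean μ F + cmean μ H := by
  have h : ∀ x, ‖F x + H x‖ ≤ C + D := fun x => (norm_add_le _ _).trans (add_le_add (hF x) (hH x))
  have h₁ : toBdd (fun x => (F x + H x).re) =
      toBdd (fun x => (F x).re) + toBdd fun x => (H x).re := lp.ext (funext fun x => by
    change _ = toBdd _ x + toBdd _ x
    rw [toBdd_apply (abs_re_le_of_norm_le h), toBdd_apply (abs_re_le_of_norm_le hF),
      toBdd_apply (abs_re_le_of_norm_le hH), Complex.add_re])
  have h₂ : toBdd (fun x => (F x + H x).im) =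
      toBdd (fun x => (F x).im) + toBdd fun x => (H x).im := lp.ext (funext fun x => by
    change _ = toBdd _ x + toBdd _ x
    rw [toBdd_apply (abs_im_le_of_norm_le h), toBdd_apply (abs_im_le_of_norm_le hF),
      toBdd_apply (abs_im_le_of_norm_le hH), Complex.add_im])
  rw [cmean, h₁, h₂, map_add, map_add, cmean, cmean]
  push_cast
  ring

theorem cmean_smul (c : ℂ) {F : G → ℂ} {C : ℝ} (hF : ∀ x, ‖F x‖ ≤ C) :
    cmean μ (fun x => c * F x) = c * cmean μ F := by
  have h : ∀ x, ‖c * F x‖ ≤ ‖c‖ * C := fun x => by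
    rw [norm_mul]; exact mul_le_mul_of_nonneg_left (hF x) (norm_nonneg _)
  have h₁ : toBdd (fun x => (c * F x).re) =
      c.re • toBdd (fun x => (F x).re) - c.im • toBdd fun x => (F x).im :=
    lp.ext (funext fun x => by
      change _ = c.re * toBdd _ x - c.im * toBdd _ x
      rw [toBdd_apply (abs_re_le_of_norm_le h), toBdd_apply (abs_re_le_of_norm_le hF),
        toBdd_apply (abs_im_le_of_norm_le hF), Complex.mul_re])
  have h₂ : toBdd (fun x => (c * F x).im) =
      c.re • toBdd (fun x => (F x).im) + c.im • toBdd fun x => (F x).re :=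
    lp.ext (funext fun x => by
      change _ = c.re * toBdd _ x + c.im * toBdd _ x
      rw [toBdd_apply (abs_im_le_of_norm_le h), toBdd_apply (abs_im_le_of_norm_le hF),
        toBdd_apply (abs_re_le_of_norm_le hF), Complex.mul_im])
  rw [cmean, h₁, h₂, map_add, map_sub, map_smul, map_smul, map_smul, map_smul, cmean]
  apply Complex.ext <;> simp

variable {μ}

theorem cmean_const (h1 : μ 1 = 1) (c : ℂ) : cmean μ (fun _ => c) = c := by
  have h : ∀ r : ℝ, toBdd (fun _ : G => r) = r • (1 : BddFun G) := fun r =>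
    lp.ext (funext fun x => by
      change _ = r * (1 : BddFun G) x
      rw [toBdd_apply fun _ => le_rfl, bdd_one_apply, mul_one])
  rw [cmean, h, h, map_smul, map_smul, h1]
  simp [Complex.re_add_im]

theorem abs_mean_le (hpos : ∀ f, (∀ x, 0 ≤ f x) → 0 ≤ μ f) (h1 : μ 1 = 1) (f : BddFun G) :
    |μ f| ≤ ‖f‖ := by
  have h : ∀ g : BddFun G, μ g ≤ ‖g‖ := fun g => by
    have := hpos (‖g‖ • (1 : BddFun G) - g) fun x => by
      change 0 ≤ ‖g‖ * (1 : BddFun G) x - g x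
      rw [bdd_one_apply, mul_one]
      linarith [le_abs_self (g x), abs_apply_le_norm g x]
    rw [map_sub, map_smul, h1, smul_eq_mul, mul_one] at this
    linarith
  rw [abs_le']
  refine ⟨h f, ?_⟩
  have := h (-f)
  rwa [map_neg, norm_neg] at this

/-- Real and imaginary parts are estimated separately, whence the factor `2`; only boundedness
matters later. -/
theorem norm_cmean_le (hpos : ∀ f, (∀ x, 0 ≤ f x) → 0 ≤ μ f) (h1 : μ 1 = 1) {F : G → ℂ} {C : ℝ}
    (hC : 0 ≤ C) (hF : ∀ x, ‖F x‖ ≤ C) : ‖cmean μ F‖ ≤ 2 * C := by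
  have key : ∀ f : G → ℝ, (∀ x, |f x| ≤ C) → |μ (toBdd f)| ≤ C := fun f hf =>
    (abs_mean_le hpos h1 _).trans (norm_le_of_abs_le hC fun x => by rw [toBdd_apply hf]; exact hf x)
  refine (norm_add_le _ _).trans ?_
  rw [norm_mul, Complex.norm_I, mul_one, Complex.norm_real, Complex.norm_real, two_mul]
  exact add_le_add (key _ (abs_re_le_of_norm_le hF)) (key _ (abs_im_le_of_norm_le hF))

theorem cmean_leftTranslate [Group G] (hinv : ∀ g f, μ (leftTranslate g f) = μ f) (k : G)
    {F : G → ℂ} {C : ℝ} (hF : ∀ x, ‖F x‖ ≤ C) : cmean μ (fun x => F (k * x)) = cmean μ F := by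
  have key : ∀ f : G → ℝ, (∀ x, |f x| ≤ C) →
      toBdd (fun x => f (k * x)) = leftTranslate k (toBdd f) :=
    fun f hf => lp.ext (funext fun x => by
      rw [toBdd_apply fun x => hf (k * x), leftTranslate_apply, toBdd_apply hf])
  rw [cmean, key _ (abs_re_le_of_norm_le hF), key _ (abs_im_le_of_norm_le hF), hinv, hinv, cmean]

variable {X : Type*} [NormedAddCommGroup X] [NormedSpace ℂ X]

theorem norm_functional_le {x : G → X} {C : ℝ} (hx : ∀ h, ‖x h‖ ≤ C) (Φ : StrongDual ℂ X) (h : G) :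
    ‖Φ (x h)‖ ≤ ‖Φ‖ * C :=
  (Φ.le_opNorm _).trans (mul_le_mul_of_nonneg_left (hx h) Φ.opNorm_nonneg)

/-- The mean in `X**` of a bounded family in `X`. -/
def meanBidual (hpos : ∀ f, (∀ x, 0 ≤ f x) → 0 ≤ μ f) (h1 : μ 1 = 1) (x : G → X) (C : ℝ)
    (hC : 0 ≤ C) (hx : ∀ h, ‖x h‖ ≤ C) : StrongDual ℂ (StrongDual ℂ X) :=
  LinearMap.mkContinuous
    { toFun := fun Φ => cmean μ fun h => Φ (x h)
      map_add' := fun Φ Ψ => cmean_add μ (norm_functional_le hx Φ) (norm_functional_le hx Ψ)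
      map_smul' := fun c Φ => cmean_smul μ c (norm_functional_le hx Φ) }
    (2 * C) fun Φ => by
      refine (norm_cmean_le hpos h1 (mul_nonneg Φ.opNorm_nonneg hC)
        (norm_functional_le hx Φ)).trans_eq ?_
      ring

end ComplexMean

namespace BanachAlg

variable {X Y : Type*} [NormedAddCommGroup X] [NormedSpace ℂ X]
  [NormedAddCommGroup Y] [NormedSpace ℂ Y]

theorem biadj_inclusion (U : X →L[ℂ] Y) (x : X) :
    biadj U (NormedSpace.inclusionInDoubleDual ℂ X x) =
      NormedSpace.inclusionInDoubleDual ℂ Y (U x) := rfl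

/-- The map `a ↦ (L a)** m` evaluated at a functional, as a functional of `a`. -/
def biadjEval (L : Y →L[ℂ] X →L[ℂ] X) (m : StrongDual ℂ (StrongDual ℂ X)) (Φ : StrongDual ℂ X) :
    StrongDual ℂ Y :=
  m.comp ((ContinuousLinearMap.compL ℂ X X ℂ Φ).comp L)

end BanachAlg

/-! ### Sufficiency: diagonals built from invariant means -/

namespace InverseSemigroup

open L1Alg BanachAlg

variable {S : Type*} [InverseSemigroup S] {T : L1Alg S ≃L[ℂ] L1Alg S}

/-- A choice of invariant means on all maximal subgroups. -/
structure MeanSystem (S : Type*) [InverseSemigroup S] where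
  mean (p : {p : S // IsIdempotentElem p}) : BddFun (MaxSubgroup p) →ₗ[ℝ] ℝ
  nonneg (p) (f : BddFun (MaxSubgroup p)) : (∀ x, 0 ≤ f x) → 0 ≤ mean p f
  one (p) : mean p 1 = 1
  leftInvariant (p) (g : MaxSubgroup p) (f : BddFun (MaxSubgroup p)) :
    mean p (leftTranslate g f) = mean p f

variable (T) in
/-- The elementary tensor of the arrows `a h` and `h⁻¹ b`. -/
def cornerTensor {p : {p : S // IsIdempotentElem p}} (a b : S) (h : MaxSubgroup p) :
    ProjSq (L1Alg S) :=
  tmul (gbasis T (a * h.val)) (gbasis T (h.val⁻¹ * b))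

theorem norm_cornerTensor_le {p : {p : S // IsIdempotentElem p}} (a b : S) (h : MaxSubgroup p) :
    ‖cornerTensor T a b h‖ ≤ ‖(T.symm : L1Alg S →L[ℂ] L1Alg S)‖ ^ 2 := by
  rw [sq]
  exact (norm_tmul_le _ _).trans (mul_le_mul (norm_gbasis_le T _) (norm_gbasis_le T _)
    (norm_nonneg _) (norm_nonneg _))

variable (T) in
/-- The mean over `h ∈ G_p` of the elementary tensors of the arrows `a h` and `h⁻¹ b`. -/
def corner (μ : MeanSystem S) (p : {p : S // IsIdempotentElem p}) (a b : S) :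
    StrongDual ℂ (StrongDual ℂ (ProjSq (L1Alg S))) :=
  meanBidual (μ.nonneg p) (μ.one p) (cornerTensor T a b)
    (‖(T.symm : L1Alg S →L[ℂ] L1Alg S)‖ ^ 2) (sq_nonneg _) (norm_cornerTensor_le a b)

variable {μ : MeanSystem S} {p : {p : S // IsIdempotentElem p}} {a b : S}

theorem corner_apply (Φ : StrongDual ℂ (ProjSq (L1Alg S))) :
    corner T μ p a b Φ = cmean (μ.mean p) fun h => Φ (cornerTensor T a b h) := rfl

theorem lid_inv_val (h : MaxSubgroup p) : lid h.val⁻¹ = p.1 := (lid_inv _).trans (rid_val h)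

theorem rid_inv_val (h : MaxSubgroup p) : rid h.val⁻¹ = p.1 := (rid_inv _).trans (lid_val h)

theorem lactSq_cornerTensor (hT : IsGroupoidTransform T) (ha : rid a = p.1) (s : S)
    (hs : rid s = lid a) (h : MaxSubgroup p) :
    lactSq (gbasis T s) (cornerTensor T a b h) = cornerTensor T (s * a) b h := by
  rw [cornerTensor, lactSq_tmul, hT.gbasis_mul, if_pos, ← mul_assoc, cornerTensor]
  rw [lid_mul_of_eq (ha.trans (lid_val h).symm), hs]

theorem lactSq_cornerTensor_of_ne (hT : IsGroupoidTransform T) (ha : rid a = p.1) (s : S)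
    (hs : rid s ≠ lid a) (h : MaxSubgroup p) :
    lactSq (gbasis T s) (cornerTensor T a b h) = 0 := by
  rw [cornerTensor, lactSq_tmul, hT.gbasis_mul, if_neg, ← tmulL_apply, map_zero, zero_apply]
  rwa [lid_mul_of_eq (ha.trans (lid_val h).symm)]

theorem ractSq_cornerTensor (hT : IsGroupoidTransform T) (hb : lid b = p.1) (s : S)
    (hs : rid b = lid s) (h : MaxSubgroup p) :
    ractSq (gbasis T s) (cornerTensor T a b h) = cornerTensor T a (b * s) h := by
  rw [cornerTensor, ractSq_tmul, hT.gbasis_mul, if_pos, mul_assoc, cornerTensor]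
  rw [rid_mul_of_eq ((rid_inv_val h).trans hb.symm), hs]

theorem ractSq_cornerTensor_of_ne (hT : IsGroupoidTransform T) (hb : lid b = p.1) (s : S)
    (hs : rid b ≠ lid s) (h : MaxSubgroup p) :
    ractSq (gbasis T s) (cornerTensor T a b h) = 0 := by
  rw [cornerTensor, ractSq_tmul, hT.gbasis_mul, if_neg, ← tmulL_apply, map_zero]
  rwa [rid_mul_of_eq ((rid_inv_val h).trans hb.symm)]

open scoped Classical in
theorem biadj_lactSq_corner (hT : IsGroupoidTransform T) (ha : rid a = p.1) (s : S) :
    biadj (lactSq (gbasis T s)) (corner T μ p a b) =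
      if rid s = lid a then corner T μ p (s * a) b else 0 := by
  ext Φ
  rw [biadj_apply, corner_apply]
  simp only [adj_apply]
  by_cases hs : rid s = lid a
  · simp only [lactSq_cornerTensor hT ha s hs, if_pos hs, corner_apply]
  · simp only [lactSq_cornerTensor_of_ne hT ha s hs, if_neg hs, map_zero]
    rw [cmean_const (μ.one p)]
    rfl

open scoped Classical in
theorem biadj_ractSq_corner (hT : IsGroupoidTransform T) (hb : lid b = p.1) (s : S) :
    biadj (ractSq (gbasis T s)) (corner T μ p a b) =
      if rid b = lid s then corner T μ p a (b * s) else 0 := by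
  ext Φ
  rw [biadj_apply, corner_apply]
  simp only [adj_apply]
  by_cases hs : rid b = lid s
  · simp only [ractSq_cornerTensor hT hb s hs, if_pos hs, corner_apply]
  · simp only [ractSq_cornerTensor_of_ne hT hb s hs, if_neg hs, map_zero]
    rw [cmean_const (μ.one p)]
    rfl

/-- Substituting `k h` for `h` turns `a h ⊗ h⁻¹ k b` into `a k h ⊗ h⁻¹ b`, and left invariance says
the mean is unchanged. Group elements thus pass across the tensor sign, which gives the diagonal its
centrality. -/
theorem corner_mul_val (hb : lid b = p.1) (k : MaxSubgroup p) :
    corner T μ p (a * k.val) b = corner T μ p a (k.val * b) := by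
  ext Φ
  rw [corner_apply, corner_apply,
    ← cmean_leftTranslate (μ.leftInvariant p) k (C := ‖Φ‖ * ‖(T.symm : L1Alg S →L[ℂ] L1Alg S)‖ ^ 2)
      (norm_functional_le (norm_cornerTensor_le a (k.val * b)) Φ)]
  congr 1
  funext h
  have h₁ : (k * h).val = k.val * h.val := rfl
  have h₂ : h.val⁻¹ * k.val⁻¹ * (k.val * b) = h.val⁻¹ * b := by
    rw [mul_assoc, ← mul_assoc k.val⁻¹, ← rid, rid_val, ← hb, lid_mul]
  rw [cornerTensor, cornerTensor, h₁, mul_inv_rev', h₂, mul_assoc]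

/-- Every averaged tensor `a h ⊗ h⁻¹ b` multiplies out to `a b`, so the mean is that of a constant.
-/
theorem biadj_prodMor_corner (hT : IsGroupoidTransform T) (ha : rid a = p.1) (hb : lid b = p.1) :
    biadj (prodMor (L1Alg S)) (corner T μ p a b) =
      NormedSpace.inclusionInDoubleDual ℂ (L1Alg S) (gbasis T (a * b)) := by
  ext f
  rw [biadj_apply, corner_apply]
  have h : ∀ h : MaxSubgroup p, adj (prodMor (L1Alg S)) f (cornerTensor T a b h) =
      f (gbasis T (a * b)) := fun h => by
    rw [adj_apply, cornerTensor, prodMor_tmul, hT.gbasis_mul, if_pos]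
    · rw [mul_assoc, ← mul_assoc h.val, ← lid, lid_val, ← hb, lid_mul]
    · rw [rid_mul_of_eq (ha.trans (lid_val h).symm), lid_mul_of_eq ((rid_inv_val h).trans hb.symm),
        rid_val, lid_inv_val]
  simp only [h]
  rw [cmean_const (μ.one p)]
  rfl

/-- Representatives of the `𝔇`-classes of idempotents, with connecting arrows. -/
theorem exists_representatives (S : Type*) [InverseSemigroup S] :
    ∃ (r : S → {p : S // IsIdempotentElem p}) (x : S → S),
      (∀ e, IsIdempotentElem e → lid (x e) = (r e).1 ∧ rid (x e) = e) ∧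
      ∀ s, r (lid s) = r (rid s) := by
  classical
  let R : Setoid {p : S // IsIdempotentElem p} :=
    { r := fun e f => ∃ x, lid x = e.1 ∧ rid x = f.1
      iseqv :=
        { refl := fun e => ⟨e.1, lid_idem e.2, rid_idem e.2⟩
          symm := fun ⟨x, h₁, h₂⟩ => ⟨x⁻¹, (lid_inv x).trans h₂, (rid_inv x).trans h₁⟩
          trans := fun ⟨x, h₁, h₂⟩ ⟨y, h₃, h₄⟩ =>
            have h : rid x = lid y := h₂.trans h₃.symm
            ⟨x * y, (lid_mul_of_eq h).trans h₁, (rid_mul_of_eq h).trans h₄⟩ } }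
  -- Passing to `rid e` extends the choice to all of `S`; on idempotents it changes nothing.
  let q : S → {p : S // IsIdempotentElem p} := fun e => ⟨rid e, idem_rid e⟩
  let r : S → {p : S // IsIdempotentElem p} := fun e => (Quotient.mk R (q e)).out
  have hr : ∀ e, ∃ x, lid x = (r e).1 ∧ rid x = rid e := fun e =>
    Quotient.exact (s := R) (Quotient.out_eq (Quotient.mk R (q e)))
  choose x hx using hr
  refine ⟨r, x, fun e he => ⟨(hx e).1, (hx e).2.trans (rid_idem he)⟩, fun s => ?_⟩
  have : Quotient.mk R (q (lid s)) = Quotient.mk R (q (rid s)) :=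
    Quotient.sound ⟨s, (rid_idem (idem_lid s)).symm, (rid_idem (idem_rid s)).symm⟩
  simp only [r, this]

variable {r : S → {p : S // IsIdempotentElem p}} {x : S → S}

variable (T μ r x) in
/-- The approximate diagonal supported on a finite set of idempotents. -/
def diagonal (E : Finset S) : StrongDual ℂ (StrongDual ℂ (ProjSq (L1Alg S))) :=
  ∑ e ∈ E, corner T μ (r e) (x e)⁻¹ (x e)

/-- A set of idempotents which is a union of classes of `𝔇`-equivalent idempotents. -/
def DClosed (E : Finset S) : Prop :=
  (∀ e ∈ E, IsIdempotentElem e) ∧ ∀ s : S, lid s ∈ E ↔ rid s ∈ E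

/-- On the left only the summand at `rid s` survives, on the right only the one at `lid s`;
`𝔇`-closedness makes both present or both absent. If present, the two differ by an element of the
representative's group, moved across by `corner_mul_val`. -/
theorem biadj_diagonal_gbasis (hT : IsGroupoidTransform T)
    (hx : ∀ e, IsIdempotentElem e → lid (x e) = (r e).1 ∧ rid (x e) = e)
    (hr : ∀ s, r (lid s) = r (rid s)) {E : Finset S} (hE : DClosed E) (s : S) :
    biadj (lactSq (gbasis T s)) (diagonal T μ r x E) =
      biadj (ractSq (gbasis T s)) (diagonal T μ r x E) := by
  classical
  rw [diagonal, map_sum, map_sum]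
  have hL : ∀ e ∈ E, biadj (lactSq (gbasis T s)) (corner T μ (r e) (x e)⁻¹ (x e)) =
      if rid s = e then corner T μ (r e) (s * (x e)⁻¹) (x e) else 0 := fun e he => by
    have h := hx e (hE.1 e he)
    rw [biadj_lactSq_corner hT ((rid_inv _).trans h.1), lid_inv, h.2]
  have hR : ∀ e ∈ E, biadj (ractSq (gbasis T s)) (corner T μ (r e) (x e)⁻¹ (x e)) =
      if lid s = e then corner T μ (r e) (x e)⁻¹ (x e * s) else 0 := fun e he => by
    have h := hx e (hE.1 e he)
    rw [biadj_ractSq_corner hT h.1, h.2]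
    simp only [eq_comm]
  rw [Finset.sum_congr rfl hL, Finset.sum_congr rfl hR, Finset.sum_ite_eq, Finset.sum_ite_eq]
  by_cases hs : lid s ∈ E
  · rw [if_pos hs, if_pos ((hE.2 s).1 hs)]
    have h₁ := hx _ (idem_lid s)
    have h₂ := hx _ (idem_rid s)
    rw [hr s] at h₁ ⊢
    set y := x (lid s)
    set z := x (rid s)
    have c₁ : rid s = lid z⁻¹ := by rw [lid_inv, h₂.2]
    have c₂ : rid y = lid (s * z⁻¹) := by rw [lid_mul_of_eq c₁, h₁.2]
    -- The loop `k = y s z⁻¹` at the representative satisfies `s z⁻¹ = y⁻¹ k` and `k z = y s`.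
    let k : MaxSubgroup (r (rid s)) := ⟨y * (s * z⁻¹), (lid_mul_of_eq c₂).trans h₁.1,
      (rid_mul_of_eq c₂).trans ((rid_mul_of_eq c₁).trans ((rid_inv z).trans h₂.1))⟩
    have e₁ : s * z⁻¹ = y⁻¹ * k.val := by
      change _ = y⁻¹ * (y * (s * z⁻¹))
      rw [← mul_assoc y⁻¹, ← rid, h₁.2, ← mul_assoc, lid_mul]
    have e₂ : k.val * z = y * s := by
      change y * (s * z⁻¹) * z = _
      rw [mul_assoc, mul_assoc, ← rid, h₂.2, mul_rid]
    rw [e₁, corner_mul_val h₂.1, e₂]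
  · rw [if_neg hs, if_neg fun h => hs ((hE.2 s).2 h)]

theorem biadj_diagonal (hT : IsGroupoidTransform T)
    (hx : ∀ e, IsIdempotentElem e → lid (x e) = (r e).1 ∧ rid (x e) = e)
    (hr : ∀ s, r (lid s) = r (rid s)) {E : Finset S} (hE : DClosed E) (a : L1Alg S) :
    biadj (lactSq a) (diagonal T μ r x E) = biadj (ractSq a) (diagonal T μ r x E) := by
  ext Φ
  have h : biadjEval (lactL (L1Alg S)) (diagonal T μ r x E) Φ =
      biadjEval (ractL (L1Alg S)) (diagonal T μ r x E) Φ :=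
    ext_gbasis T fun s => DFunLike.congr_fun (biadj_diagonal_gbasis hT hx hr hE s) Φ
  exact DFunLike.congr_fun h a

variable (T) in
/-- The sum of the identities at a finite set of idempotents. -/
def localUnit (E : Finset S) : L1Alg S := ∑ e ∈ E, gbasis T e

theorem biadj_prodMor_diagonal (hT : IsGroupoidTransform T)
    (hx : ∀ e, IsIdempotentElem e → lid (x e) = (r e).1 ∧ rid (x e) = e)
    {E : Finset S} (hE : DClosed E) :
    biadj (prodMor (L1Alg S)) (diagonal T μ r x E) =
      NormedSpace.inclusionInDoubleDual ℂ (L1Alg S) (localUnit T E) := by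
  rw [diagonal, localUnit, map_sum, map_sum]
  refine Finset.sum_congr rfl fun e he => ?_
  have h := hx e (hE.1 e he)
  rw [biadj_prodMor_corner hT ((rid_inv _).trans h.1) h.1, ← rid, h.2]

open scoped Classical in
theorem gbasis_mul_localUnit (hT : IsGroupoidTransform T) {E : Finset S} (hE : DClosed E) (s : S) :
    gbasis T s * localUnit T E = if rid s ∈ E then gbasis T s else 0 := by
  have h : ∀ e ∈ E, gbasis T s * gbasis T e = if rid s = e then gbasis T s else 0 := fun e he => by
    rw [hT.gbasis_mul, lid_idem (hE.1 e he)]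
    refine ite_congr rfl (fun h => ?_) fun _ => rfl
    rw [← h, mul_rid]
  rw [localUnit, Finset.mul_sum, Finset.sum_congr rfl h, Finset.sum_ite_eq]

open scoped Classical in
theorem localUnit_mul_gbasis (hT : IsGroupoidTransform T) {E : Finset S} (hE : DClosed E) (s : S) :
    localUnit T E * gbasis T s = if lid s ∈ E then gbasis T s else 0 := by
  have h : ∀ e ∈ E, gbasis T e * gbasis T s = if lid s = e then gbasis T s else 0 := fun e he => by
    rw [hT.gbasis_mul, rid_idem (hE.1 e he)]
    refine ite_congr (propext eq_comm) (fun h => ?_) fun _ => rfl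
    rw [← h, lid_mul]
  rw [localUnit, Finset.sum_mul, Finset.sum_congr rfl h, Finset.sum_ite_eq]

/-- The local unit keeps arrows with right end in `E` on one side and left end in `E` on the other;
for `𝔇`-closed `E` these are the same arrows. -/
theorem mul_localUnit_comm (hT : IsGroupoidTransform T) {E : Finset S} (hE : DClosed E)
    (a : L1Alg S) : a * localUnit T E = localUnit T E * a := by
  classical
  have h : mulRight (localUnit T E) = mulLeft (localUnit T E) := ext_gbasis T fun s => by
    change gbasis T s * localUnit T E = localUnit T E * gbasis T s
    rw [gbasis_mul_localUnit hT hE, localUnit_mul_gbasis hT hE]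
    exact ite_eq_ite_of_iff (hE.2 s).symm rfl rfl
  exact DFunLike.congr_fun h a

theorem hasSum_smul_map_gbasis {F : Type*} [NormedAddCommGroup F] [NormedSpace ℂ F]
    (U : L1Alg S →L[ℂ] F) (a : L1Alg S) :
    HasSum (fun s => (T a) s • U (gbasis T s)) (U a) := by
  have h := (hasSum_single (T a)).mapL (U.comp (T.symm : L1Alg S →L[ℂ] L1Alg S))
  simpa [gbasis] using h

/-- Expand `a` in groupoid coordinates: each term becomes constant once `E` contains its right end,
and the `ℓ¹` coordinates of `a` times `‖T⁻¹‖` dominate the series. -/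
theorem tendsto_mul_localUnit (hT : IsGroupoidTransform T)
    (hfin : ∀ s : S, ∃ E, DClosed E ∧ rid s ∈ E) (a : L1Alg S) :
    Tendsto (fun E : {E : Finset S // DClosed E} => a * localUnit T E.1) atTop (𝓝 a) := by
  classical
  have h₁ : ∀ E : {E : Finset S // DClosed E}, a * localUnit T E.1 =
      ∑' s, (T a) s • (gbasis T s * localUnit T E.1) := fun E =>
    (hasSum_smul_map_gbasis (T := T) (mulRight (localUnit T E.1)) a).tsum_eq.symm
  have h₂ : a = ∑' s, (T a) s • gbasis T s :=
    (hasSum_smul_map_gbasis (T := T) (ContinuousLinearMap.id ℂ _) a).tsum_eq.symm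
  simp only [h₁]
  nth_rw 2 [h₂]
  refine tendsto_tsum_of_dominated_convergence
    ((T a).hasSum_norm.summable.mul_right ‖(T.symm : L1Alg S →L[ℂ] L1Alg S)‖) (fun s => ?_)
    (Eventually.of_forall fun E s => ?_)
  · obtain ⟨E₀, hE₀, hs⟩ := hfin s
    refine tendsto_const_nhds.congr' ?_
    filter_upwards [eventually_ge_atTop (⟨E₀, hE₀⟩ : {E : Finset S // DClosed E})] with E hE
    rw [gbasis_mul_localUnit hT E.2, if_pos (hE hs)]
  · rw [norm_smul, gbasis_mul_localUnit hT E.2]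
    refine mul_le_mul_of_nonneg_left ?_ (norm_nonneg _)
    split_ifs
    · exact norm_gbasis_le T s
    · rw [norm_zero]; exact norm_nonneg _

/-- The idempotents of the `𝔇`-class of `s` serve as `E`; finiteness of the class enters here. -/
theorem exists_dClosed (hfin : ∀ s : S, {e : S | IsIdempotentElem e ∧ DRel s e}.Finite) (s : S) :
    ∃ E, DClosed E ∧ rid s ∈ E := by
  refine ⟨(hfin s).toFinset, ⟨fun e he => ((hfin s).mem_toFinset.1 he).1, fun t => ?_⟩, ?_⟩
  · simp only [Set.Finite.mem_toFinset, Set.mem_ofPred_eq, idem_lid, idem_rid, true_and]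
    constructor
    · rintro ⟨y, h₁, h₂⟩
      have h₃ : rid y = lid t := Eq.trans (Eq.symm h₂) (rid_idem (idem_lid t))
      exact ⟨y * t, h₁.trans (lid_mul_of_eq h₃).symm,
        (rid_idem (idem_rid t)).trans (rid_mul_of_eq h₃).symm⟩
    · rintro ⟨y, h₁, h₂⟩
      have h₃ : rid y = lid t⁻¹ :=
        Eq.trans (Eq.symm h₂) ((rid_idem (idem_rid t)).trans (lid_inv t).symm)
      exact ⟨y * t⁻¹, h₁.trans (lid_mul_of_eq h₃).symm,
        (rid_idem (idem_lid t)).trans ((rid_mul_of_eq h₃).trans (rid_inv t)).symm⟩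
  · rw [(hfin s).mem_toFinset]
    exact ⟨idem_rid s, s, rfl, rid_idem (idem_rid s)⟩

theorem dClosed_empty : DClosed (∅ : Finset S) := by simp [DClosed]

open scoped Classical in
theorem DClosed.union {E E' : Finset S} (h : DClosed E) (h' : DClosed E') : DClosed (E ∪ E') := by
  refine ⟨fun e he => ?_, fun s => ?_⟩
  · rcases Finset.mem_union.1 he with he | he
    · exact h.1 e he
    · exact h'.1 e he
  · rw [Finset.mem_union, Finset.mem_union, h.2 s, h'.2 s]

theorem strongPseudoAmenable_of_amenable (hT : IsGroupoidTransform T)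
    (ham : ∀ p : {p : S // IsIdempotentElem p}, AmenableGroup (MaxSubgroup p))
    (hfin : ∀ s : S, {e : S | IsIdempotentElem e ∧ DRel s e}.Finite) :
    StrongPseudoAmenable (L1Alg S) := by
  classical
  choose M hM using ham
  let μ : MeanSystem S := ⟨M, fun p => (hM p).1, fun p => (hM p).2.1, fun p => (hM p).2.2⟩
  obtain ⟨r, x, hx, hr⟩ := exists_representatives S
  -- The net is indexed by `𝔇`-closed finite sets under inclusion, directed by unions. Its
  -- commutators vanish identically, and no bound on the diagonals is required.
  refine ⟨{E : Finset S // DClosed E}, inferInstance,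
    ⟨fun E E' => ⟨⟨E.1 ∪ E'.1, E.2.union E'.2⟩, Finset.subset_union_left,
      Finset.subset_union_right⟩⟩, ⟨⟨∅, dClosed_empty⟩⟩, fun E => diagonal T μ r x E.1, fun a => ?_⟩
  have hπ : ∀ E : {E : Finset S // DClosed E}, biadj (prodMor (L1Alg S)) (diagonal T μ r x E.1) =
      NormedSpace.inclusionInDoubleDual ℂ (L1Alg S) (localUnit T E.1) := fun E =>
    biadj_prodMor_diagonal hT hx E.2
  refine ⟨?_, fun E => ?_, ?_⟩
  · refine tendsto_const_nhds.congr fun E => ?_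
    exact (sub_eq_zero.2 (biadj_diagonal hT hx hr E.2 a)).symm
  · rw [hπ, biadj_inclusion, biadj_inclusion]
    exact congrArg _ (mul_localUnit_comm hT E.2 a)
  · simp only [hπ, biadj_inclusion]
    exact ((NormedSpace.inclusionInDoubleDual ℂ (L1Alg S)).continuous.tendsto a).comp
      (tendsto_mul_localUnit hT (exists_dClosed hfin) a)

end InverseSemigroup

end

theorem mainTheorem2 {S : Type*} [InverseSemigroup S]
    (hS : InverseSemigroup.IdempotentsUniformlyLocallyFinite S) :
    BanachAlg.StrongPseudoAmenable (L1Alg S) ↔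
      (∀ p : {p : S // IsIdempotentElem p}, AmenableGroup (InverseSemigroup.MaxSubgroup p)) ∧
      (∀ s : S, {e : S | IsIdempotentElem e ∧ InverseSemigroup.DRel s e}.Finite) := by
  obtain ⟨T, hT⟩ := InverseSemigroup.exists_groupoidTransform hS
  exact ⟨fun h => ⟨InverseSemigroup.amenableGroup_of_strongPseudoAmenable hT h,
    InverseSemigroup.finite_of_strongPseudoAmenable hT h⟩,
    fun h => InverseSemigroup.strongPseudoAmenable_of_amenable hT h.1 h.2⟩
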